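/- Let $C_A>0$, let $\nu>0$ be an even integer and let $L\ge 0$. For $0\le\ell\le L$ let $A_\ell\in\mathbb{R}^{n_\ell\times n_\ell}$ be symmetric positive definite, and for $1\le\ell\le L$ let $I_{\ell-1}^{\ell}\in\mathbb{R}^{n_\ell\times n_{\ell-1}}$ be prolongation matrices with $A_{\ell-1}=I_\ell^{\ell-1}A_\ell I_{\ell-1}^{\ell}$, where $I_\ell^{\ell-1}:=(I_{\ell-1}^{\ell})^\top$. For $1\le\ell\le L$ let $M_\ell$ be symmetric matrices satisfying the smoothing property $0<A_\ell\le M_\ell$ (Loewner order) and the approximation property $$\bigl\|M_\ell^{1/2}\bigl(A_\ell^{-1}-I_{\ell-1}^{\ell}A_{\ell-1}^{-1}I_\ell^{\ell-1}\bigr)M_\ell^{1/2}\bigr\|_2\le C_A .$$ Let $\mathrm{MGMC}_\ell(f,\cdot)$ be the Multigrid Monte Carlo V-cycle update with exact coarse sampler: $\mathrm{MGMC}_0(f,\theta)\sim\mathcal N(A_0^{-1}f,A_0^{-1})$; for $\ell\ge1$ one (i) applies $\nu/2$ random smoothing steps $\theta\mapsto\theta+M_\ell^{-1}(f+\xi-A_\ell\theta)$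 with $\xi\sim\mathcal N(0,M_\ell+M_\ell^\top-A_\ell)$, (ii) replaces $\theta$ by $\theta+I_{\ell-1}^{\ell}\psi$ where $\psi=\mathrm{MGMC}_{\ell-1}\bigl(I_\ell^{\ell-1}(f-A_\ell\theta),0\bigr)$, and (iii) applies another $\nu/2$ random smoothing steps; all random draws are independent. Fix $f_L\in\mathbb{R}^{n_L}$ and let $\theta_L^{(0)},\theta_L^{(1)},\dots$ be a Markov chain with transitions $\theta_L^{(m+1)}=\mathrm{MGMC}_L(f_L,\theta_L^{(m)})$ and an arbitrary initial state $\theta_L^{(0)}$ with finite second moments. Write $\|v\|_{A_L}=(v^\top A_Lv)^{1/2}$ for vectors, $\|X\|_{A_L}=\|A_L^{1/2}XA_L^{-1/2}\|_2$ for matrices, $\mathrm{Cov}(X,Y)=\mathbb{E}[(X-\mathbb{E}X)(Y-\mathbb{E}Y)^\top]$ and $\mathrm{Cov}(X)=\mathrm{Cov}(X,X)$. Then all $\theta_L^{(m)}$ have finite second moments, and for all $m,s\ge0$ $$\|\mathbb{E}[\theta_L^{(m+1)}]-A_L^{-1}f_L\|_{A_L}\le\frac{C_A}{C_A+\nu}\,\|\mathbb{E}[\theta_L^{(m)}]-A_L^{-1}f_L\|_{A_L},$$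 $$\|A_L^{1/2}\mathrm{Cov}(\theta_L^{(m+1)})A_L^{1/2}-I\|_2\le\Bigl(\frac{C_A}{C_A+\nu}\Bigr)^{2}\|A_L^{1/2}\mathrm{Cov}(\theta_L^{(m)})A_L^{1/2}-I\|_2,$$ and hence $$\|A_L^{1/2}\mathrm{Cov}(\theta_L^{(m)})A_L^{1/2}-I\|_2\le\Bigl(\frac{C_A}{C_A+\nu}\Bigr)^{2m}\|A_L^{1/2}\mathrm{Cov}(\theta_L^{(0)})A_L^{1/2}-I\|_2;$$ furthermore $$\|\mathrm{Cov}(\theta_L^{(m+s)},\theta_L^{(m)})\|_{A_L}\le\Bigl(\frac{C_A}{C_A+\nu}\Bigr)^{s}\|\mathrm{Cov}(\theta_L^{(m)},\theta_L^{(m)})\|_{A_L}.$$ Moreover, if $\mathrm{Cov}(\theta_L^{(0)})\ne A_L^{-1}$, then the following limit exists and satisfies $$\lim_{m\to\infty}\left(\frac{\|\mathrm{Cov}(\theta_L^{(m)})-A_L^{-1}\|_{A_L}}{\|\mathrm{Cov}(\theta_L^{(0)})-A_L^{-1}\|_{A_L}}\right)^{1/m}\le\Bigl(\frac{C_A}{C_A+\nu}\Bigr)^{2}.$$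 Here $C_A$ is the constant of the approximation property; in particular, the contraction factor does not depend on $L$ as long as $C_A$ does not. -/

import Mathlib

open MeasureTheory ProbabilityTheory Filter
open scoped Matrix Topology MatrixOrder Matrix.Norms.L2Operator

noncomputable section

namespace MGMC

/-- The state space `ℝⁿ` with its Euclidean structure. -/
abbrev E (n : ℕ) : Type := EuclideanSpace ℝ (Fin n)

/-- The matrix-vector product, as a map between Euclidean spaces. -/
def act {m n : ℕ} (B : Matrix (Fin m) (Fin n) ℝ) (x : E n) : E m :=
  WithLp.toLp 2 (B *ᵥ x.ofLp)

@[fun_prop]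
theorem continuous_act {m n : ℕ} (B : Matrix (Fin m) (Fin n) ℝ) : Continuous (act B) := by
  unfold act
  fun_prop

@[fun_prop]
theorem measurable_act {m n : ℕ} (B : Matrix (Fin m) (Fin n) ℝ) : Measurable (act B) :=
  (continuous_act B).measurable

/-! ### The sampling algorithm

All random updates are Markov kernels with input `(f, θ)`, the right-hand side `f` and the current
state `θ`, and output the new state. -/

/-- One step of the random smoother with splitting matrix `M`:
`θ' = θ + M⁻¹ (f + ξ - A θ)` with fresh noise `ξ ∼ N(0, M + Mᵀ - A)`. -/
def randomSmoother {n : ℕ} (A M : Matrix (Fin n) (Fin n) ℝ) : Kernel (E n × E n) (E n) :=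
  (Kernel.id ×ₖ Kernel.const (E n × E n) (multivariateGaussian 0 (M + Mᵀ - A))).map
    (fun p : (E n × E n) × E n => p.1.2 + act M⁻¹ (p.1.1 + p.2 - act A p.1.2))

instance {n : ℕ} (A M : Matrix (Fin n) (Fin n) ℝ) : IsMarkovKernel (randomSmoother A M) := by
  unfold randomSmoother
  exact Kernel.IsMarkovKernel.map _ (by fun_prop)

/-- The exact sampler: whatever the current state, `θ' ∼ N(A⁻¹ f, A⁻¹)`, that is,
`θ' = A⁻¹ f + η` with fresh noise `η ∼ N(0, A⁻¹)`. -/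
def exactSampler {n : ℕ} (A : Matrix (Fin n) (Fin n) ℝ) : Kernel (E n × E n) (E n) :=
  (Kernel.id ×ₖ Kernel.const (E n × E n) (multivariateGaussian 0 A⁻¹)).map
    (fun p : (E n × E n) × E n => act A⁻¹ p.1.1 + p.2)

instance {n : ℕ} (A : Matrix (Fin n) (Fin n) ℝ) : IsMarkovKernel (exactSampler A) := by
  unfold exactSampler
  exact Kernel.IsMarkovKernel.map _ (by fun_prop)

/-- First apply the update `κ`, then the update `η`, with the same right-hand side. -/
def andThen {n : ℕ} (κ η : Kernel (E n × E n) (E n)) : Kernel (E n × E n) (E n) :=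
  η ∘ₖ (Kernel.deterministic (Prod.fst : E n × E n → E n) measurable_fst ×ₖ κ)

instance {n : ℕ} (κ η : Kernel (E n × E n) (E n)) [IsMarkovKernel κ] [IsMarkovKernel η] :
    IsMarkovKernel (andThen κ η) := by
  unfold andThen
  infer_instance

/-- `j` successive (independent) applications of the update `κ`, with the same right-hand side. -/
def repeated {n : ℕ} (κ : Kernel (E n × E n) (E n)) : ℕ → Kernel (E n × E n) (E n)
  | 0 => Kernel.deterministic Prod.snd measurable_snd
  | j + 1 => andThen (repeated κ j) κ

instance {n : ℕ} (κ : Kernel (E n × E n) (E n)) [IsMarkovKernel κ] (j : ℕ) :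
    IsMarkovKernel (repeated κ j) := by
  induction j with
  | zero => unfold repeated; infer_instance
  | succ j ih => unfold repeated; infer_instance

/-- The coarse level correction: with the restricted residual `g = Pᵀ (f - A θ)` as right-hand side,
apply the coarse update `κ` successively `γ` times, starting from `0`, to get `ψ`;
the new state is `θ + P ψ`. -/
def coarseCorrection {n k : ℕ} (A : Matrix (Fin n) (Fin n) ℝ) (P : Matrix (Fin n) (Fin k) ℝ)
    (γ : ℕ) (κ : Kernel (E k × E k) (E k)) : Kernel (E n × E n) (E n) :=
  (Kernel.id ×ₖ (repeated κ γ).comap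
      (fun p : E n × E n => (act Pᵀ (p.1 - act A p.2), (0 : E k))) (by fun_prop)).map
    (fun q : (E n × E n) × E k => q.1.2 + act P q.2)

instance {n k : ℕ} (A : Matrix (Fin n) (Fin n) ℝ) (P : Matrix (Fin n) (Fin k) ℝ)
    (γ : ℕ) (κ : Kernel (E k × E k) (E k)) [IsMarkovKernel κ] :
    IsMarkovKernel (coarseCorrection A P γ κ) := by
  unfold coarseCorrection
  exact Kernel.IsMarkovKernel.map _ (by fun_prop)

/-- The Multigrid Monte Carlo update on level `ℓ`, for matrices `A ℓ` of size `n ℓ`, prolongation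
matrices `P ℓ` from level `ℓ` to level `ℓ + 1`, splitting matrices `Mpre ℓ`, `Mpost ℓ` of the
pre- and post-smoother, `ν₁` pre- and `ν₂` post-smoothing steps, cycle parameters `γ ℓ` and a
given sampler on the coarsest level `0`. -/
def mgmc (n : ℕ → ℕ) (A : (ℓ : ℕ) → Matrix (Fin (n ℓ)) (Fin (n ℓ)) ℝ)
    (P : (ℓ : ℕ) → Matrix (Fin (n (ℓ + 1))) (Fin (n ℓ)) ℝ)
    (Mpre Mpost : (ℓ : ℕ) → Matrix (Fin (n ℓ)) (Fin (n ℓ)) ℝ) (ν₁ ν₂ : ℕ) (γ : ℕ → ℕ)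
    (coarse : Kernel (E (n 0) × E (n 0)) (E (n 0))) :
    (ℓ : ℕ) → Kernel (E (n ℓ) × E (n ℓ)) (E (n ℓ))
  | 0 => coarse
  | ℓ + 1 =>
    andThen
      (andThen (repeated (randomSmoother (A (ℓ + 1)) (Mpre (ℓ + 1))) ν₁)
        (coarseCorrection (A (ℓ + 1)) (P ℓ) (γ (ℓ + 1))
          (mgmc n A P Mpre Mpost ν₁ ν₂ γ coarse ℓ)))
      (repeated (randomSmoother (A (ℓ + 1)) (Mpost (ℓ + 1))) ν₂)

instance (n : ℕ → ℕ) (A : (ℓ : ℕ) → Matrix (Fin (n ℓ)) (Fin (n ℓ)) ℝ)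
    (P : (ℓ : ℕ) → Matrix (Fin (n (ℓ + 1))) (Fin (n ℓ)) ℝ)
    (Mpre Mpost : (ℓ : ℕ) → Matrix (Fin (n ℓ)) (Fin (n ℓ)) ℝ) (ν₁ ν₂ : ℕ) (γ : ℕ → ℕ)
    (coarse : Kernel (E (n 0) × E (n 0)) (E (n 0))) [IsMarkovKernel coarse] (ℓ : ℕ) :
    IsMarkovKernel (mgmc n A P Mpre Mpost ν₁ ν₂ γ coarse ℓ) := by
  induction ℓ with
  | zero => unfold mgmc; infer_instance
  | succ ℓ ih => unfold mgmc; infer_instance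

/-- The transition kernel `θ ↦ θ'` of an update with the right-hand side `f` held fixed. -/
def withRhs {n : ℕ} (κ : Kernel (E n × E n) (E n)) (f : E n) : Kernel (E n) (E n) :=
  κ.comap (fun θ => (f, θ)) (by fun_prop)

instance {n : ℕ} (κ : Kernel (E n × E n) (E n)) [IsMarkovKernel κ] (f : E n) :
    IsMarkovKernel (withRhs κ f) := by
  unfold withRhs
  infer_instance

/-- `θ 0, θ 1, …` is a time-homogeneous Markov chain with transition kernel `κ`: the conditional
distribution of `θ (m + 1)` given the whole past `(θ 0, …, θ m)` is `κ (θ m)`. -/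
def IsMarkovChain {S Ω : Type*} [MeasurableSpace S] [MeasurableSpace Ω] (κ : Kernel S S)
    (θ : ℕ → Ω → S) (μ : Measure Ω) : Prop :=
  ∀ m : ℕ, HasCondDistrib (θ (m + 1)) (fun ω (i : Fin (m + 1)) => θ i ω)
    (κ.comap (fun h : Fin (m + 1) → S => h (Fin.last m)) (measurable_pi_apply _)) μ

/-! ### Norms, covariances, and the two properties of the hierarchy -/

/-- The energy norm `‖v‖_A = (vᵀ A v)^{1/2}` of a vector. -/
def vecEnergyNorm {n : ℕ} (A : Matrix (Fin n) (Fin n) ℝ) (v : E n) : ℝ :=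
  Real.sqrt (v.ofLp ⬝ᵥ A *ᵥ v.ofLp)

/-- The energy norm `‖X‖_A = ‖A^{1/2} X A^{-1/2}‖₂` of a matrix (`‖·‖` is the spectral norm). -/
def energyNorm {n : ℕ} (A X : Matrix (Fin n) (Fin n) ℝ) : ℝ :=
  ‖CFC.sqrt A * X * (CFC.sqrt A)⁻¹‖

/-- The cross-covariance matrix `E[(X - E X) (Y - E Y)ᵀ]`. -/
def crossCov {Ω : Type*} [MeasurableSpace Ω] {n : ℕ} (X Y : Ω → E n) (μ : Measure Ω) :
    Matrix (Fin n) (Fin n) ℝ :=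
  Matrix.of fun i j => cov[fun ω => X ω i, fun ω => Y ω j; μ]

/-- The smoothing property `0 < A ≤ M` of a symmetric splitting matrix `M`. -/
def SmoothingProperty {n : ℕ} (A M : Matrix (Fin n) (Fin n) ℝ) : Prop :=
  M.IsSymm ∧ A.PosDef ∧ (M - A).PosSemidef

/-- The approximation property with constant `C` on the levels `1, …, L`:
`‖M_ℓ^{1/2} (A_ℓ⁻¹ - P A_{ℓ-1}⁻¹ Pᵀ) M_ℓ^{1/2}‖₂ ≤ C`. -/
def ApproximationProperty (n : ℕ → ℕ) (A : (ℓ : ℕ) → Matrix (Fin (n ℓ)) (Fin (n ℓ)) ℝ)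
    (P : (ℓ : ℕ) → Matrix (Fin (n (ℓ + 1))) (Fin (n ℓ)) ℝ)
    (M : (ℓ : ℕ) → Matrix (Fin (n ℓ)) (Fin (n ℓ)) ℝ) (L : ℕ) (C : ℝ) : Prop :=
  ∀ ℓ < L, ‖CFC.sqrt (M (ℓ + 1)) * ((A (ℓ + 1))⁻¹ - P ℓ * (A ℓ)⁻¹ * (P ℓ)ᵀ) *
    CFC.sqrt (M (ℓ + 1))‖ ≤ C

end MGMC

end

/-! Every ingredient of the cycle (smoother, coarse correction, exact sampler) is affine in the
state and the right-hand side, plus fresh centred noise. The first two moments of the chain are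
therefore governed by one matrix per level, the iteration matrix `X` of the deterministic V-cycle.
Each ingredient leaves the mean `A⁻¹ f` and the covariance `A⁻¹` invariant. This forces the noise
covariance to be `A⁻¹ - X A⁻¹ Xᵀ`, a form that survives composition (`IsAffineUpdate.andThen`) and
the passage from a coarse to a fine level (`IsAffineUpdate.coarseCorrection`). Consequently the
error of the mean is multiplied by `X`, the error `K` of the covariance becomes `X K Xᵀ`, and the
covariance at lag `s` picks up the factor `X ^ s`.

What remains is the V-cycle bound `0 ≤ A X ≤ η A` with `η = C_A / (C_A + ν)`, by induction on the
level (`cycle_step`). The coarse bound leaves a convex combination, with weights `1 - η` and `η`, of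
the error of the exact coarse correction and of `A`. The approximation property bounds the former by
`C_A A M⁻¹ A`, and smoothing absorbs the result because `(1 - w) ^ ν * (1 + ν w) ≤ 1` on `[0, 1]`
(`smoothing_scalar`).

Conjugation by `A^{1/2}` turns `X` into a symmetric `T` with `‖T‖ ≤ η` (`exists_symm_similar`),
which gives the factors `η`, `η ^ 2` and `η ^ s`. The limit exists because, in an eigenbasis of `T`,
the entries of `T ^ m D T ^ m` are exact geometric sequences (`exists_geometric_bounds`). -/

namespace MGMC

/-! ### Loewner order, spectral norm, and the smoothing inequality -/

section LinearAlgebra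

variable {n k : ℕ}

theorem _root_.Matrix.PosDef.sqrt_facts {A : Matrix (Fin n) (Fin n) ℝ} (hA : A.PosDef) :
    CFC.sqrt A * CFC.sqrt A = A ∧ (CFC.sqrt A)ᵀ = CFC.sqrt A ∧ IsUnit (CFC.sqrt A).det := by
  have h1 : CFC.sqrt A * CFC.sqrt A = A := CFC.sqrt_mul_sqrt_self A hA.posSemidef.nonneg
  refine ⟨h1, ?_, ?_⟩
  · have h := (Matrix.nonneg_iff_posSemidef.1 (CFC.sqrt_nonneg A)).isHermitian.eq
    rwa [Matrix.conjTranspose_eq_transpose_of_trivial] at h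
  · have h := (Matrix.isUnit_iff_isUnit_det A).1 hA.isUnit
    rw [← h1, Matrix.det_mul] at h
    exact isUnit_of_mul_isUnit_left h

theorem transpose_mul_mul_le {X Y : Matrix (Fin n) (Fin n) ℝ} (h : X ≤ Y)
    (B : Matrix (Fin n) (Fin k) ℝ) : Bᵀ * X * B ≤ Bᵀ * Y * B := by
  have h' := (Matrix.le_iff.1 h).conjTranspose_mul_mul_same B
  rw [Matrix.conjTranspose_eq_transpose_of_trivial, Matrix.mul_sub, Matrix.sub_mul] at h'
  exact Matrix.le_iff.2 h'

theorem transpose_mul_mul_nonneg {X : Matrix (Fin n) (Fin n) ℝ} (h : 0 ≤ X)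
    (B : Matrix (Fin n) (Fin k) ℝ) : 0 ≤ Bᵀ * X * B := by
  simpa using transpose_mul_mul_le h B

theorem smul_le_smul_matrix {X Y : Matrix (Fin n) (Fin n) ℝ} (h : X ≤ Y) {c : ℝ} (hc : 0 ≤ c) :
    c • X ≤ c • Y := by
  rw [Matrix.le_iff, ← smul_sub]
  exact (Matrix.le_iff.1 h).smul hc

theorem norm_le_of_nonneg_of_le {T : Matrix (Fin n) (Fin n) ℝ} {c : ℝ} (hc : 0 ≤ c)
    (h0 : 0 ≤ T) (h1 : T ≤ c • 1) : ‖T‖ ≤ c := by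
  have hT := (Matrix.nonneg_iff_posSemidef.1 h0)
  have hs : ∀ x ∈ spectrum ℝ T, x ≤ c := by
    rw [← le_algebraMap_iff_spectrum_le (a := T) (r := c) hT.isHermitian,
      Algebra.algebraMap_eq_smul_one]
    exact h1
  have hsp := hT.isHermitian.spectral_theorem
  rw [Unitary.conjStarAlgAut_apply] at hsp
  rw [hsp, ← Unitary.coe_star, CStarRing.norm_mul_coe_unitary, CStarRing.norm_coe_unitary_mul,
    Matrix.l2_opNorm_diagonal, pi_norm_le_iff_of_nonneg hc]
  intro i
  have h2 := hT.eigenvalues_nonneg i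
  have h3 := hs _ (hT.isHermitian.eigenvalues_mem_spectrum_real i)
  simpa [abs_of_nonneg h2] using h3

theorem le_smul_one_of_norm_le {N : Matrix (Fin n) (Fin n) ℝ} (hN : Nᵀ = N) {c : ℝ}
    (h : ‖N‖ ≤ c) : N ≤ c • 1 := by
  have hN' : IsSelfAdjoint N := by
    rw [IsSelfAdjoint, Matrix.star_eq_conjTranspose,
      Matrix.conjTranspose_eq_transpose_of_trivial, hN]
  rw [← Algebra.algebraMap_eq_smul_one, le_algebraMap_iff_spectrum_le (a := N) (r := c) hN']
  intro x hx
  have h1 := spectrum.norm_le_norm_mul_of_mem hx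
  -- Only an inequality: for `n = 0` the identity has norm `0`.
  have h2 : ‖(1 : Matrix (Fin n) (Fin n) ℝ)‖ ≤ 1 := by
    rw [← Matrix.diagonal_one, Matrix.l2_opNorm_diagonal, pi_norm_le_iff_of_nonneg zero_le_one]
    simp
  have h3 : x ≤ ‖x‖ := le_abs_self x
  nlinarith [norm_nonneg N]

/-- The value `η = c / (c + ν)` is the one with `(1 - η) c = η ν`: the bracket then factors as `η w
(1 + ν w)`. Bernoulli gives `1 + ν w ≤ (1 + w) ^ ν`, and `(1 - w ^ 2) ^ ν ≤ 1`. -/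
theorem smoothing_scalar {c w : ℝ} (hc : 0 < c) (ν : ℕ) (h0 : 0 ≤ w) (h1 : w ≤ 1) :
    (1 - w) ^ ν * ((1 - c / (c + ν)) * c * w ^ 2 + c / (c + ν) * w) ≤ c / (c + ν) * w := by
  have hcν : 0 < c + ν := by positivity
  have hb : 1 + (ν : ℝ) * w ≤ (1 + w) ^ ν := one_add_mul_le_pow (by linarith) ν
  have h2 : (1 - w) ^ ν * (1 + ν * w) ≤ 1 := by
    calc (1 - w) ^ ν * (1 + ν * w) ≤ (1 - w) ^ ν * (1 + w) ^ ν :=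
          mul_le_mul_of_nonneg_left hb (pow_nonneg (by linarith) ν)
      _ = ((1 - w) * (1 + w)) ^ ν := (mul_pow _ _ _).symm
      _ ≤ 1 := pow_le_one₀ (mul_nonneg (by linarith) (by linarith)) (by nlinarith)
  have h3 : (1 - w) ^ ν * ((1 - c / (c + ν)) * c * w ^ 2 + c / (c + ν) * w) =
      (c / (c + ν) * w) * ((1 - w) ^ ν * (1 + ν * w)) := by
    field_simp
    ring
  rw [h3]
  exact mul_le_of_le_one_right (by positivity) h2

open Polynomial in
theorem aeval_nonneg_of_unit_interval {W : Matrix (Fin n) (Fin n) ℝ} (h0 : 0 ≤ W) (h1 : W ≤ 1)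
    (q : ℝ[X]) (hq : ∀ w, 0 ≤ w → w ≤ 1 → 0 ≤ q.eval w) : 0 ≤ aeval W q := by
  have hs : ∀ x ∈ spectrum ℝ W, x ≤ 1 := by
    rw [← le_algebraMap_iff_spectrum_le (a := W) (r := (1 : ℝ))
      (Matrix.nonneg_iff_posSemidef.1 h0).isHermitian]
    simpa using h1
  rw [← cfc_polynomial q W (Matrix.nonneg_iff_posSemidef.1 h0).isHermitian]
  exact cfc_nonneg fun x hx => hq x (spectrum_nonneg_of_nonneg h0 hx) (hs x hx)

open Polynomial in
-- Functional calculus transfers the scalar inequality to `W`. The even power is split into equal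
-- left and right factors so that it matches pre- and post-smoothing.
theorem smoothing_matrix {W : Matrix (Fin n) (Fin n) ℝ} (h0 : 0 ≤ W) (h1 : W ≤ 1) {a b : ℝ} {j : ℕ}
    (h : ∀ w : ℝ, 0 ≤ w → w ≤ 1 → (1 - w) ^ (2 * j) * (a * w ^ 2 + b * w) ≤ b * w) :
    (1 - W) ^ j * (a • (W * W) + b • W) * (1 - W) ^ j ≤ b • W := by
  have hq := aeval_nonneg_of_unit_interval h0 h1
    (C b * X - (1 - X) ^ j * (C a * (X * X) + C b * X) * (1 - X) ^ j) (fun w hw0 hw1 => by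
      have h2 := h w hw0 hw1
      rw [two_mul, pow_add] at h2
      simp only [eval_sub, eval_mul, eval_C, eval_X, eval_pow, eval_one, eval_add]
      linarith)
  rw [map_sub, map_mul, map_mul, map_mul, map_add, map_pow, map_sub, map_mul, map_mul, map_mul,
    map_one, aeval_C, aeval_C, aeval_X, Algebra.algebraMap_eq_smul_one,
    Algebra.algebraMap_eq_smul_one, smul_mul_assoc, one_mul, smul_mul_assoc, one_mul] at hq
  exact sub_nonneg.1 hq

/-- With `W = M^{-1/2} A M^{-1/2}`, the smoothing property reads `0 ≤ W ≤ 1` and `1 - M⁻¹ A` is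
similar to `1 - W` through `M^{1/2}`. The claim is `smoothing_matrix` conjugated by `M^{1/2}`. -/
theorem smoothing_property {A M : Matrix (Fin n) (Fin n) ℝ} (hA : A.PosDef) (hM : M.PosDef)
    (h : A ≤ M) {c : ℝ} (hc : 0 < c) (j : ℕ) :
    ((1 - M⁻¹ * A) ^ j)ᵀ * (((1 - c / (c + (2 * j : ℕ))) * c) • (A * M⁻¹ * A) +
      (c / (c + (2 * j : ℕ))) • A) * (1 - M⁻¹ * A) ^ j ≤ (c / (c + (2 * j : ℕ))) • A := by
  obtain ⟨hRR, hRt, hRu⟩ := hM.sqrt_facts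
  set R := CFC.sqrt M
  have hi1 : R⁻¹ * R = 1 := Matrix.nonsing_inv_mul R hRu
  have hi2 : R * R⁻¹ = 1 := Matrix.mul_nonsing_inv R hRu
  have hRit : (R⁻¹)ᵀ = R⁻¹ := by rw [Matrix.transpose_nonsing_inv, hRt]
  have hMi : M⁻¹ = R⁻¹ * R⁻¹ := by rw [← hRR, Matrix.mul_inv_rev]
  obtain ⟨W, hW⟩ : ∃ W, W = R⁻¹ * A * R⁻¹ := ⟨_, rfl⟩
  have hAW : A = R * W * R := by
    rw [hW]
    calc A = (R * R⁻¹) * A * (R⁻¹ * R) := by rw [hi1, hi2, one_mul, mul_one]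
      _ = _ := by simp only [mul_assoc]
  have hW0 : 0 ≤ W := by
    have := transpose_mul_mul_nonneg hA.posSemidef.nonneg R⁻¹
    rwa [hRit, ← hW] at this
  have hW1 : W ≤ 1 := by
    have := transpose_mul_mul_le h R⁻¹
    rw [hRit, ← hW, ← hRR] at this
    simpa [mul_assoc, hi2, hi1] using this
  have hWt : Wᵀ = W := by
    have := (Matrix.nonneg_iff_posSemidef.1 hW0).isHermitian.eq
    rwa [Matrix.conjTranspose_eq_transpose_of_trivial] at this
  have hS : 1 - M⁻¹ * A = R⁻¹ * (1 - W) * R := by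
    rw [hMi, hAW, mul_sub, mul_one, sub_mul, hi1, ← mul_assoc, ← mul_assoc, mul_assoc R⁻¹ R⁻¹ R, hi1,
      mul_one]
  have hSj : ∀ i : ℕ, (1 - M⁻¹ * A) ^ i = R⁻¹ * (1 - W) ^ i * R := by
    intro i
    induction i with
    | zero => simp [hi1]
    | succ i ih =>
      rw [pow_succ, ih, hS, pow_succ]
      calc _ = R⁻¹ * (1 - W) ^ i * (R * R⁻¹) * (1 - W) * R := by simp only [mul_assoc]
        _ = _ := by rw [hi2, mul_one]; simp only [mul_assoc]
  have hAMA : A * M⁻¹ * A = R * (W * W) * R := by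
    rw [hAW, hMi]
    calc _ = R * W * (R * R⁻¹) * (R⁻¹ * R) * W * R := by simp only [mul_assoc]
      _ = _ := by rw [hi1, hi2, mul_one, mul_one]; simp only [mul_assoc]
  have key := transpose_mul_mul_le (smoothing_matrix hW0 hW1
    (fun w => smoothing_scalar hc (2 * j))) R
  rw [hSj, Matrix.transpose_mul, Matrix.transpose_mul, hRt, hRit, Matrix.transpose_pow,
    Matrix.transpose_sub, Matrix.transpose_one, hWt, hAMA]
  rw [hRt] at key
  set η := c / (c + (2 * j : ℕ))
  have e1 : ((1 - η) * c) • (R * (W * W) * R) + η • A =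
      R * (((1 - η) * c) • (W * W) + η • W) * R := by
    rw [hAW]
    simp only [mul_add, add_mul, mul_smul_comm, smul_mul_assoc]
  have e2 : η • A = R * (η • W) * R := by
    rw [hAW]; simp only [mul_smul_comm, smul_mul_assoc]
  rw [e1, e2]
  refine le_of_eq_of_le ?_ key
  calc _ = R * (1 - W) ^ j * (R⁻¹ * R) * (((1 - η) * c) • (W * W) + η • W) * (R * R⁻¹) *
        (1 - W) ^ j * R := by simp only [mul_assoc]
    _ = _ := by rw [hi1, hi2, mul_one, mul_one]; simp only [mul_assoc]

end LinearAlgebra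

/-! ### Energy bounds for the V-cycle iteration matrix -/

section VCycle

variable {n k : ℕ}

/-- The iteration matrix of a coarse level correction whose coarse solver has the iteration
matrix `X`. -/
noncomputable def correctionMatrix (A : Matrix (Fin n) (Fin n) ℝ) (P : Matrix (Fin n) (Fin k) ℝ)
    (Ac X : Matrix (Fin k) (Fin k) ℝ) : Matrix (Fin n) (Fin n) ℝ :=
  1 - P * ((1 - X) * Ac⁻¹) * Pᵀ * A

/-- The iteration matrix of the symmetric V-cycle with exact coarse solver and `j` pre- and
post-smoothing steps. -/
noncomputable def cycleMatrix (n : ℕ → ℕ) (A : (ℓ : ℕ) → Matrix (Fin (n ℓ)) (Fin (n ℓ)) ℝ)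
    (P : (ℓ : ℕ) → Matrix (Fin (n (ℓ + 1))) (Fin (n ℓ)) ℝ)
    (M : (ℓ : ℕ) → Matrix (Fin (n ℓ)) (Fin (n ℓ)) ℝ) (j : ℕ) :
    (ℓ : ℕ) → Matrix (Fin (n ℓ)) (Fin (n ℓ)) ℝ
  | 0 => 0
  | ℓ + 1 => (1 - (M (ℓ + 1))⁻¹ * A (ℓ + 1)) ^ j *
      (correctionMatrix (A (ℓ + 1)) (P ℓ) (A ℓ) (cycleMatrix n A P M j ℓ) *
        (1 - (M (ℓ + 1))⁻¹ * A (ℓ + 1)) ^ j)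

theorem mul_smoother_pow {A M : Matrix (Fin n) (Fin n) ℝ} (hA : Aᵀ = A) (hM : Mᵀ = M) (j : ℕ) :
    A * (1 - M⁻¹ * A) ^ j = ((1 - M⁻¹ * A) ^ j)ᵀ * A := by
  have h1 : A * (1 - M⁻¹ * A) = (1 - M⁻¹ * A)ᵀ * A := by
    rw [Matrix.transpose_sub, Matrix.transpose_mul, Matrix.transpose_nonsing_inv, hA, hM,
      Matrix.transpose_one, mul_sub, sub_mul, mul_one, one_mul, mul_assoc]
  induction j with
  | zero => simp
  | succ j ih =>
    rw [pow_succ, ← mul_assoc, ih, mul_assoc, h1, ← mul_assoc, ← Matrix.transpose_mul,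
      ← pow_succ', ← pow_succ]

/-- By the Galerkin condition `P Ac⁻¹ Pᵀ A` is the `A`-orthogonal projection onto the range of `P`.
With `Q` the complementary projection, the matrix in question equals `Qᵀ A Q`. -/
theorem correction_nonneg {A : Matrix (Fin n) (Fin n) ℝ} {P : Matrix (Fin n) (Fin k) ℝ}
    {Ac : Matrix (Fin k) (Fin k) ℝ} (hA : A.PosDef) (hAc : Ac.PosDef) (hG : Ac = Pᵀ * A * P) :
    0 ≤ A - A * P * Ac⁻¹ * Pᵀ * A := by
  have hAt : Aᵀ = A := by
    rw [← Matrix.conjTranspose_eq_transpose_of_trivial]; exact hA.isHermitian.eq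
  have hAct : Acᵀ = Ac := by
    rw [← Matrix.conjTranspose_eq_transpose_of_trivial]; exact hAc.isHermitian.eq
  have hi : Ac⁻¹ * Ac = 1 :=
    Matrix.nonsing_inv_mul _ ((Matrix.isUnit_iff_isUnit_det _).1 hAc.isUnit)
  have h := transpose_mul_mul_nonneg hA.posSemidef.nonneg (1 - P * Ac⁻¹ * Pᵀ * A)
  refine le_of_le_of_eq h ?_
  have e : (1 - P * Ac⁻¹ * Pᵀ * A)ᵀ = 1 - A * P * Ac⁻¹ * Pᵀ := by
    simp only [Matrix.transpose_sub, Matrix.transpose_mul, Matrix.transpose_one,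
      Matrix.transpose_transpose, Matrix.transpose_nonsing_inv, hAt, hAct, Matrix.mul_assoc]
  have e2 : A * P * Ac⁻¹ * Pᵀ * A * (P * Ac⁻¹ * Pᵀ * A) = A * P * Ac⁻¹ * Pᵀ * A := by
    calc _ = A * P * (Ac⁻¹ * (Pᵀ * A * P)) * Ac⁻¹ * Pᵀ * A := by simp only [Matrix.mul_assoc]
      _ = _ := by rw [← hG, hi, Matrix.mul_one]
  rw [e, Matrix.mul_sub, Matrix.mul_one, Matrix.sub_mul, Matrix.sub_mul, Matrix.one_mul, e2]
  simp only [Matrix.mul_assoc, sub_self, sub_zero]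

/-- The approximation property as a Loewner bound: a symmetric matrix is at most its norm times the
identity, and conjugation by `M^{-1/2}` and then by `A` preserves the order. -/
theorem approximation_le {A M : Matrix (Fin n) (Fin n) ℝ} {P : Matrix (Fin n) (Fin k) ℝ}
    {Ac : Matrix (Fin k) (Fin k) ℝ} (hA : A.PosDef) (hM : M.PosDef) (hAc : Ac.PosDef) {c : ℝ}
    (h : ‖CFC.sqrt M * (A⁻¹ - P * Ac⁻¹ * Pᵀ) * CFC.sqrt M‖ ≤ c) :
    A - A * P * Ac⁻¹ * Pᵀ * A ≤ c • (A * M⁻¹ * A) := by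
  have hAt : Aᵀ = A := by
    rw [← Matrix.conjTranspose_eq_transpose_of_trivial]; exact hA.isHermitian.eq
  have hAct : Acᵀ = Ac := by
    rw [← Matrix.conjTranspose_eq_transpose_of_trivial]; exact hAc.isHermitian.eq
  have hi : A * A⁻¹ = 1 :=
    Matrix.mul_nonsing_inv _ ((Matrix.isUnit_iff_isUnit_det _).1 hA.isUnit)
  obtain ⟨hRR, hRt, hRu⟩ := hM.sqrt_facts
  set R := CFC.sqrt M
  have hi1 : R⁻¹ * R = 1 := Matrix.nonsing_inv_mul R hRu
  have hi2 : R * R⁻¹ = 1 := Matrix.mul_nonsing_inv R hRu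
  have hRit : (R⁻¹)ᵀ = R⁻¹ := by rw [Matrix.transpose_nonsing_inv, hRt]
  have hMi : M⁻¹ = R⁻¹ * R⁻¹ := by rw [← hRR, Matrix.mul_inv_rev]
  set K := A⁻¹ - P * Ac⁻¹ * Pᵀ with hK
  have hKt : Kᵀ = K := by
    simp only [hK, Matrix.transpose_sub, Matrix.transpose_mul, Matrix.transpose_transpose,
      Matrix.transpose_nonsing_inv, hAt, hAct, Matrix.mul_assoc]
  have hN : R * K * R ≤ c • 1 := le_smul_one_of_norm_le
    (by simp only [Matrix.transpose_mul, hRt, hKt, Matrix.mul_assoc]) h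
  have h2 := transpose_mul_mul_le (transpose_mul_mul_le hN R⁻¹) A
  rw [hRit, hAt] at h2
  have e1 : R⁻¹ * (R * K * R) * R⁻¹ = K := by
    calc _ = (R⁻¹ * R) * K * (R * R⁻¹) := by simp only [mul_assoc]
      _ = _ := by rw [hi1, hi2, one_mul, mul_one]
  have e2 : A * K * A = A - A * P * Ac⁻¹ * Pᵀ * A := by
    rw [hK, Matrix.mul_sub, Matrix.sub_mul, hi, Matrix.one_mul]
    simp only [Matrix.mul_assoc]
  rw [e1, e2] at h2
  refine h2.trans_eq ?_
  rw [hMi, mul_smul_comm, smul_mul_assoc, mul_smul_comm, smul_mul_assoc, mul_one]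

/-- The two-level step of the V-cycle convergence theorem: if the iteration matrix `X` of the coarse
solver satisfies `0 ≤ A X ≤ c / (c + 2 j) A`, then so does the one on the fine level. -/
theorem cycle_step {A M : Matrix (Fin n) (Fin n) ℝ} {P : Matrix (Fin n) (Fin k) ℝ}
    {Ac X : Matrix (Fin k) (Fin k) ℝ} (hA : A.PosDef) (hAc : Ac.PosDef) (hMt : Mᵀ = M)
    (hAM : A ≤ M) (hG : Ac = Pᵀ * A * P) {c : ℝ} (hc : 0 < c)
    (h : ‖CFC.sqrt M * (A⁻¹ - P * Ac⁻¹ * Pᵀ) * CFC.sqrt M‖ ≤ c) (j : ℕ)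
    (hX0 : 0 ≤ Ac * X) (hX1 : Ac * X ≤ (c / (c + (2 * j : ℕ))) • Ac) :
    0 ≤ A * ((1 - M⁻¹ * A) ^ j * (correctionMatrix A P Ac X * (1 - M⁻¹ * A) ^ j)) ∧
    A * ((1 - M⁻¹ * A) ^ j * (correctionMatrix A P Ac X * (1 - M⁻¹ * A) ^ j)) ≤
      (c / (c + (2 * j : ℕ))) • A := by
  have hM : M.PosDef := by
    have := hA.add_posSemidef (Matrix.le_iff.1 hAM)
    rwa [add_sub_cancel] at this
  have hAt : Aᵀ = A := by
    rw [← Matrix.conjTranspose_eq_transpose_of_trivial]; exact hA.isHermitian.eq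
  have hAct : Acᵀ = Ac := by
    rw [← Matrix.conjTranspose_eq_transpose_of_trivial]; exact hAc.isHermitian.eq
  have hi : Ac⁻¹ * Ac = 1 :=
    Matrix.nonsing_inv_mul _ ((Matrix.isUnit_iff_isUnit_det _).1 hAc.isUnit)
  have hsm := smoothing_property hA hM hAM hc j
  set η := c / (c + (2 * j : ℕ)) with hη
  have hη1 : 0 ≤ 1 - η := by
    rw [sub_nonneg, hη]
    exact (div_le_one (by positivity)).2 (by simp)
  set S := (1 - M⁻¹ * A) ^ j with hS
  have hB : A * (S * (correctionMatrix A P Ac X * S)) =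
      Sᵀ * (A - A * P * Ac⁻¹ * Pᵀ * A + A * P * (X * Ac⁻¹) * Pᵀ * A) * S := by
    rw [← Matrix.mul_assoc, hS, mul_smoother_pow hAt hMt, ← hS, correctionMatrix]
    simp only [Matrix.mul_assoc, Matrix.mul_sub, Matrix.sub_mul, Matrix.one_mul, Matrix.mul_add,
      Matrix.add_mul]
    abel
  -- This congruence carries the bounds on `Ac X` over to `X Ac⁻¹`, the matrix that enters the fine
  -- level.
  have hY : X * Ac⁻¹ = (Ac⁻¹)ᵀ * (Ac * X) * Ac⁻¹ := by
    rw [Matrix.transpose_nonsing_inv, hAct, ← Matrix.mul_assoc, hi, Matrix.one_mul]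
  have hY0 : 0 ≤ X * Ac⁻¹ := hY ▸ transpose_mul_mul_nonneg hX0 Ac⁻¹
  have hY1 : X * Ac⁻¹ ≤ η • Ac⁻¹ := by
    rw [hY]
    refine (transpose_mul_mul_le hX1 Ac⁻¹).trans_eq ?_
    rw [Matrix.transpose_nonsing_inv, hAct, mul_smul_comm, smul_mul_assoc, hi, one_mul]
  have eP : ∀ Z : Matrix (Fin k) (Fin k) ℝ, (Pᵀ * A)ᵀ * Z * (Pᵀ * A) = A * P * Z * Pᵀ * A := by
    intro Z
    simp only [Matrix.transpose_mul, Matrix.transpose_transpose, hAt, Matrix.mul_assoc]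
  have hZ0 : 0 ≤ A * P * (X * Ac⁻¹) * Pᵀ * A := eP _ ▸ transpose_mul_mul_nonneg hY0 (Pᵀ * A)
  have hZ1 : A * P * (X * Ac⁻¹) * Pᵀ * A ≤ η • (A * P * Ac⁻¹ * Pᵀ * A) := by
    have := transpose_mul_mul_le hY1 (Pᵀ * A)
    rw [eP, eP] at this
    refine this.trans_eq ?_
    simp only [Matrix.mul_smul, Matrix.smul_mul]
  have hQ0 := correction_nonneg hA hAc hG
  have hQ1 := approximation_le hA hM hAc h
  rw [hB]
  refine ⟨transpose_mul_mul_nonneg (add_nonneg hQ0 hZ0) S, le_trans ?_ hsm⟩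
  refine transpose_mul_mul_le ?_ S
  have h3 := smul_le_smul_matrix hQ1 hη1
  -- The coarse term is at most `η` times the part of `A` that the exact correction removes.
  -- Regrouping gives weights `1 - η` and `η`, and the approximation property applies to the first
  -- summand since `1 - η ≥ 0`.
  calc A - A * P * Ac⁻¹ * Pᵀ * A + A * P * (X * Ac⁻¹) * Pᵀ * A
      ≤ A - A * P * Ac⁻¹ * Pᵀ * A + η • (A * P * Ac⁻¹ * Pᵀ * A) := by gcongr
    _ = (1 - η) • (A - A * P * Ac⁻¹ * Pᵀ * A) + η • A := by
      rw [sub_smul, one_smul, smul_sub]; abel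
    _ ≤ (1 - η) • c • (A * M⁻¹ * A) + η • A := by gcongr
    _ = _ := by rw [smul_smul]

theorem cycleMatrix_bounds {n : ℕ → ℕ} {A : (ℓ : ℕ) → Matrix (Fin (n ℓ)) (Fin (n ℓ)) ℝ}
    {P : (ℓ : ℕ) → Matrix (Fin (n (ℓ + 1))) (Fin (n ℓ)) ℝ}
    {M : (ℓ : ℕ) → Matrix (Fin (n ℓ)) (Fin (n ℓ)) ℝ} {L : ℕ} {c : ℝ} (hc : 0 < c) (j : ℕ)
    (hA : ∀ ℓ ≤ L, (A ℓ).PosDef)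
    (hG : ∀ ℓ < L, A ℓ = (P ℓ)ᵀ * A (ℓ + 1) * P ℓ)
    (hS : ∀ ℓ < L, SmoothingProperty (A (ℓ + 1)) (M (ℓ + 1)))
    (hApp : ApproximationProperty n A P M L c) :
    ∀ ℓ ≤ L, 0 ≤ A ℓ * cycleMatrix n A P M j ℓ ∧
      A ℓ * cycleMatrix n A P M j ℓ ≤ (c / (c + (2 * j : ℕ))) • A ℓ := by
  intro ℓ
  induction ℓ with
  | zero =>
    intro h0
    have : 0 ≤ (c / (c + (2 * j : ℕ))) • A 0 :=
      Matrix.nonneg_iff_posSemidef.2 ((hA 0 h0).posSemidef.smul (by positivity))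
    simpa [cycleMatrix] using this
  | succ ℓ ih =>
    intro hl
    obtain ⟨h0, h1⟩ := ih (by omega)
    exact cycle_step (hA _ hl) (hA ℓ (by omega)) (hS ℓ hl).1 (Matrix.le_iff.2 (hS ℓ hl).2.2)
      (hG ℓ hl) hc (hApp ℓ hl) j h0 h1

end VCycle

/-! ### Symmetrisation by `A^{1/2}` and geometric rates -/

section Spectral

variable {n : ℕ}

/-- An iteration matrix `X` with `0 ≤ A X ≤ η A` is similar, by `A^{1/2}`, to a symmetric matrix of
spectral norm at most `η`. -/
theorem exists_symm_similar {A X : Matrix (Fin n) (Fin n) ℝ} (hA : A.PosDef) {η : ℝ} (hη : 0 ≤ η)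
    (h0 : 0 ≤ A * X) (h1 : A * X ≤ η • A) :
    ∃ T : Matrix (Fin n) (Fin n) ℝ, Tᵀ = T ∧ ‖T‖ ≤ η ∧ CFC.sqrt A * X = T * CFC.sqrt A := by
  obtain ⟨hRR, hRt, hRu⟩ := hA.sqrt_facts
  set R := CFC.sqrt A
  have hi1 : R⁻¹ * R = 1 := Matrix.nonsing_inv_mul R hRu
  have hi2 : R * R⁻¹ = 1 := Matrix.mul_nonsing_inv R hRu
  have hRit : (R⁻¹)ᵀ = R⁻¹ := by rw [Matrix.transpose_nonsing_inv, hRt]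
  have h0' := transpose_mul_mul_nonneg h0 R⁻¹
  have h1' := transpose_mul_mul_le h1 R⁻¹
  have e : R⁻¹ * A * R⁻¹ = 1 := by
    rw [← hRR, ← mul_assoc, hi1, one_mul, hi2]
  rw [hRit] at h0' h1'
  rw [mul_smul_comm, smul_mul_assoc, e] at h1'
  refine ⟨R⁻¹ * (A * X) * R⁻¹, ?_, norm_le_of_nonneg_of_le hη h0' h1', ?_⟩
  · rw [← Matrix.conjTranspose_eq_transpose_of_trivial]
    exact (Matrix.nonneg_iff_posSemidef.1 h0').isHermitian.eq
  · rw [mul_assoc, hi1, mul_one, ← mul_assoc, ← hRR, ← mul_assoc R⁻¹, hi1, one_mul]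

theorem intertwine_pow {R X T : Matrix (Fin n) (Fin n) ℝ} (h : R * X = T * R) (s : ℕ) :
    R * X ^ s = T ^ s * R := by
  induction s with
  | zero => simp
  | succ s ih => rw [pow_succ, ← mul_assoc, ih, mul_assoc, h, ← mul_assoc, ← pow_succ]

theorem norm_pow_le_pow {T : Matrix (Fin n) (Fin n) ℝ} {η : ℝ} (h : ‖T‖ ≤ η) (s : ℕ)
    (B : Matrix (Fin n) (Fin n) ℝ) : ‖T ^ s * B‖ ≤ η ^ s * ‖B‖ := by
  have hη : 0 ≤ η := (norm_nonneg T).trans h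
  induction s with
  | zero => simp
  | succ s ih =>
    rw [pow_succ', mul_assoc]
    calc ‖T * (T ^ s * B)‖ ≤ ‖T‖ * ‖T ^ s * B‖ := norm_mul_le _ _
      _ ≤ η * (η ^ s * ‖B‖) := by gcongr
      _ = _ := by ring

theorem vecEnergyNorm_eq {A : Matrix (Fin n) (Fin n) ℝ} (hA : A.PosDef) (v : E n) :
    vecEnergyNorm A v = ‖act (CFC.sqrt A) v‖ := by
  obtain ⟨hRR, hRt, -⟩ := hA.sqrt_facts
  set R := CFC.sqrt A
  rw [vecEnergyNorm, EuclideanSpace.norm_eq]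
  congr 1
  have : v.ofLp ⬝ᵥ A *ᵥ v.ofLp = (R *ᵥ v.ofLp) ⬝ᵥ (R *ᵥ v.ofLp) := by
    rw [← hRR, ← Matrix.mulVec_mulVec, Matrix.dotProduct_mulVec, ← Matrix.mulVec_transpose, hRt]
  rw [this]
  simp [act, dotProduct, sq]

theorem act_act {k m : ℕ} (B : Matrix (Fin m) (Fin n) ℝ) (C : Matrix (Fin n) (Fin k) ℝ) (v : E k) :
    act B (act C v) = act (B * C) v := by
  simp [act, Matrix.mulVec_mulVec]

theorem norm_act_le {m : ℕ} (B : Matrix (Fin m) (Fin n) ℝ) (v : E n) :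
    ‖act B v‖ ≤ ‖B‖ * ‖v‖ := Matrix.l2_opNorm_mulVec B v

theorem abs_entry_le_norm (B : Matrix (Fin n) (Fin n) ℝ) (i j : Fin n) : |B i j| ≤ ‖B‖ := by
  have h := norm_act_le B (EuclideanSpace.single j 1)
  have h2 : |act B (EuclideanSpace.single j 1) i| ≤ ‖act B (EuclideanSpace.single j 1)‖ :=
    PiLp.norm_apply_le (act B (EuclideanSpace.single j 1)) i
  simpa [act] using h2.trans h

theorem tendsto_root_of_bounds {a : ℕ → ℝ} {c₁ c₂ ρ : ℝ} (hρ : 0 ≤ ρ) (hc : 0 < c₁)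
    (h1 : ∀ m, c₁ * ρ ^ m ≤ a m) (h2 : ∀ m, a m ≤ c₂ * ρ ^ m) :
    Tendsto (fun m : ℕ => a m ^ (1 / (m : ℝ))) atTop (𝓝 ρ) := by
  have hc₂ : 0 < c₂ := by
    have := (h1 0).trans (h2 0)
    simp only [pow_zero, mul_one] at this
    linarith
  have key : ∀ c : ℝ, 0 < c →
      Tendsto (fun m : ℕ => (c * ρ ^ m) ^ (1 / (m : ℝ))) atTop (𝓝 ρ) := by
    intro c hc
    have h3 : Tendsto (fun m : ℕ => c ^ (1 / (m : ℝ)) * ρ) atTop (𝓝 (c ^ (0 : ℝ) * ρ)) :=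
      ((Real.continuousAt_const_rpow hc.ne').tendsto.comp
        (tendsto_one_div_atTop_nhds_zero_nat (𝕜 := ℝ))).mul_const ρ
    rw [Real.rpow_zero, one_mul] at h3
    refine h3.congr' ?_
    -- At `m = 0` the exponent `1 / m` is `0`, and the root does not recover `ρ`.
    filter_upwards [eventually_ge_atTop 1] with m hm
    rw [Real.mul_rpow hc.le (pow_nonneg hρ m), one_div, Real.pow_rpow_inv_natCast hρ (by omega)]
  refine tendsto_of_tendsto_of_tendsto_of_le_of_le (key c₁ hc) (key c₂ hc₂) (fun m => ?_)
    (fun m => ?_)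
  · exact Real.rpow_le_rpow (by positivity) (h1 m) (by positivity)
  · exact Real.rpow_le_rpow ((by positivity : 0 ≤ c₁ * ρ ^ m).trans (h1 m)) (h2 m) (by positivity)

/-- In an eigenbasis of `T`, with `F` the transform of `D`, the entries of `T ^ m D T ^ m` are `(d i
* d j) ^ m * F i j`. The largest `|d i * d j|` over the support of `F` is thus the exact rate `ρ`.
The change of basis and the factor `Z` are invertible, so they cost only constants. -/
theorem exists_geometric_bounds {T D Z : Matrix (Fin n) (Fin n) ℝ} (hT : Tᵀ = T) (hD : D ≠ 0)
    (hZ : IsUnit Z.det) :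
    ∃ ρ c₁ c₂ : ℝ, 0 ≤ ρ ∧ 0 < c₁ ∧ ∀ m : ℕ,
      c₁ * ρ ^ m ≤ ‖T ^ m * D * T ^ m * Z‖ ∧ ‖T ^ m * D * T ^ m * Z‖ ≤ c₂ * ρ ^ m := by
  have hT' : T.IsHermitian := by
    rw [Matrix.IsHermitian, Matrix.conjTranspose_eq_transpose_of_trivial, hT]
  have hsp := hT'.spectral_theorem
  rw [Unitary.conjStarAlgAut_apply] at hsp
  obtain ⟨U, V, hUV, hVU, d, hTd⟩ : ∃ U V : Matrix (Fin n) (Fin n) ℝ, U * V = 1 ∧ V * U = 1 ∧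
      ∃ d : Fin n → ℝ, T = U * Matrix.diagonal d * V :=
    ⟨_, _, Unitary.mul_star_self_of_mem hT'.eigenvectorUnitary.2,
      Unitary.star_mul_self_of_mem hT'.eigenvectorUnitary.2, _, hsp⟩
  have hTm : ∀ m : ℕ, T ^ m = U * Matrix.diagonal (d ^ m) * V := by
    intro m
    rw [← Matrix.diagonal_pow]
    induction m with
    | zero => simp [hUV]
    | succ m ih =>
      rw [pow_succ, ih, hTd, pow_succ]
      calc _ = U * Matrix.diagonal d ^ m * (V * U) * Matrix.diagonal d * V := by
            simp only [mul_assoc]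
        _ = _ := by rw [hVU, mul_one]; simp only [mul_assoc]
  set F := V * D * U with hF
  have hDF : D = U * F * V := by
    calc D = (U * V) * D * (U * V) := by rw [hUV, one_mul, mul_one]
      _ = _ := by simp only [hF, mul_assoc]
  have hF0 : F ≠ 0 := by
    rintro h; apply hD; rw [hDF, h]; simp
  set G : ℕ → Matrix (Fin n) (Fin n) ℝ := fun m =>
    Matrix.diagonal (d ^ m) * F * Matrix.diagonal (d ^ m) with hG
  have hGe : ∀ m i j, G m i j = (d i * d j) ^ m * F i j := by
    intro m i j
    simp only [hG, Matrix.mul_diagonal, Matrix.diagonal_mul, Pi.pow_apply, mul_pow]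
    ring
  have hE : ∀ m, T ^ m * D * T ^ m * Z = U * G m * (V * Z) := by
    intro m
    rw [hTm]
    calc _ = U * (Matrix.diagonal (d ^ m) * (V * D * U) * Matrix.diagonal (d ^ m)) * (V * Z) := by
          simp only [mul_assoc]
      _ = _ := rfl
  have hGE : ∀ m, G m = V * (T ^ m * D * T ^ m * Z) * (Z⁻¹ * U) := by
    intro m
    rw [hE]
    calc G m = (V * U) * G m * (V * (Z * Z⁻¹) * U) := by
          rw [Matrix.mul_nonsing_inv _ hZ, mul_one, hVU, mul_one, one_mul]
      _ = _ := by simp only [mul_assoc]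
  obtain ⟨i₀, j₀, hij⟩ : ∃ i j, F i j ≠ 0 := by
    by_contra! h
    exact hF0 (Matrix.ext h)
  obtain ⟨p, hp, hmax⟩ := Finset.exists_max_image
    (Finset.univ.filter fun p : Fin n × Fin n => F p.1 p.2 ≠ 0) (fun p => |d p.1 * d p.2|)
    ⟨(i₀, j₀), by simpa using hij⟩
  simp only [Finset.mem_filter, Finset.mem_univ, true_and] at hp hmax
  set ρ := |d p.1 * d p.2| with hρ
  have hρ0 : 0 ≤ ρ := abs_nonneg _
  -- `c₁` comes from the single maximising entry, where `F` does not vanish; the `+ 1` keeps its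
  -- denominator positive. `c₂` sums over all entries.
  refine ⟨ρ, |F p.1 p.2| / (‖V‖ * ‖Z⁻¹ * U‖ + 1),
    ‖U‖ * (∑ q : Fin n × Fin n, |F q.1 q.2| * ‖Matrix.single q.1 q.2 (1 : ℝ)‖) * ‖V * Z‖,
    hρ0, by positivity, fun m => ⟨?_, ?_⟩⟩
  · have h1 := abs_entry_le_norm (G m) p.1 p.2
    rw [hGe, abs_mul, abs_pow, ← hρ] at h1
    have h2 : ‖G m‖ ≤ ‖V‖ * ‖T ^ m * D * T ^ m * Z‖ * ‖Z⁻¹ * U‖ := by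
      conv_lhs => rw [hGE]
      exact (norm_mul_le _ _).trans (mul_le_mul_of_nonneg_right (norm_mul_le _ _) (norm_nonneg _))
    rw [div_mul_eq_mul_div, div_le_iff₀ (by positivity)]
    nlinarith [norm_nonneg (T ^ m * D * T ^ m * Z)]
  · have h1 : ‖G m‖ ≤
        (∑ q : Fin n × Fin n, |F q.1 q.2| * ‖Matrix.single q.1 q.2 (1 : ℝ)‖) * ρ ^ m := by
      have h3 : G m = ∑ q : Fin n × Fin n, G m q.1 q.2 • Matrix.single q.1 q.2 (1 : ℝ) := by
        rw [Fintype.sum_prod_type]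
        conv_lhs => rw [Matrix.matrix_eq_sum_single (G m)]
        simp [Matrix.smul_single]
      rw [h3, Finset.sum_mul]
      refine (norm_sum_le _ _).trans (Finset.sum_le_sum fun q _ => ?_)
      rw [norm_smul, Real.norm_eq_abs, hGe, abs_mul, abs_pow]
      by_cases hq : F q.1 q.2 = 0
      · simp [hq]
      · have h4 : |d q.1 * d q.2| ^ m ≤ ρ ^ m := pow_le_pow_left₀ (abs_nonneg _) (hmax q hq) m
        calc _ = (|F q.1 q.2| * ‖Matrix.single q.1 q.2 (1 : ℝ)‖) * |d q.1 * d q.2| ^ m := by ring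
          _ ≤ _ := by gcongr
    rw [hE]
    calc ‖U * G m * (V * Z)‖ ≤ ‖U‖ * ‖G m‖ * ‖V * Z‖ :=
          (norm_mul_le _ _).trans (mul_le_mul_of_nonneg_right (norm_mul_le _ _) (norm_nonneg _))
      _ ≤ ‖U‖ * ((∑ q : Fin n × Fin n, |F q.1 q.2| * ‖Matrix.single q.1 q.2 (1 : ℝ)‖) * ρ ^ m) *
          ‖V * Z‖ := by gcongr
      _ = _ := by ring

end Spectral

/-! ### Calculus of covariance matrices and centred noise -/

section Covariance

variable {Ω : Type*} [MeasurableSpace Ω] {μ : Measure Ω} {n k : ℕ}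

theorem memLp_act (B : Matrix (Fin k) (Fin n) ℝ) {X : Ω → E n} (hX : MemLp X 2 μ) :
    MemLp (fun ω => act B (X ω)) 2 μ :=
  (LinearMap.toContinuousLinearMap (Matrix.toEuclideanLin B)).comp_memLp' hX

theorem integral_act (B : Matrix (Fin k) (Fin n) ℝ) {X : Ω → E n} (hX : Integrable X μ) :
    ∫ ω, act B (X ω) ∂μ = act B (∫ ω, X ω ∂μ) :=
  (LinearMap.toContinuousLinearMap (Matrix.toEuclideanLin B)).integral_comp_comm hX

theorem crossCov_act [IsFiniteMeasure μ] (B C : Matrix (Fin k) (Fin n) ℝ) {X Y : Ω → E n}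
    (hX : MemLp X 2 μ) (hY : MemLp Y 2 μ) :
    crossCov (fun ω => act B (X ω)) (fun ω => act C (Y ω)) μ = B * crossCov X Y μ * Cᵀ := by
  ext i j
  have hX' : ∀ a, MemLp (fun ω => B i a * X ω a) 2 μ := fun a => (hX.eval_piLp a).const_mul _
  have hY' : ∀ a, MemLp (fun ω => C j a * Y ω a) 2 μ := fun a => (hY.eval_piLp a).const_mul _
  have h : crossCov (fun ω => act B (X ω)) (fun ω => act C (Y ω)) μ i j =
      cov[fun ω => ∑ a, B i a * X ω a, fun ω => ∑ b, C j b * Y ω b; μ] := rfl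
  rw [h, covariance_fun_sum_fun_sum hX' hY']
  simp only [covariance_const_mul_left, covariance_const_mul_right, Matrix.mul_apply, crossCov,
    Matrix.of_apply, Matrix.transpose_apply, Finset.sum_mul]
  rw [Finset.sum_comm]
  refine Finset.sum_congr rfl fun b _ => Finset.sum_congr rfl fun a _ => by ring

theorem crossCov_act_left [IsFiniteMeasure μ] (B : Matrix (Fin n) (Fin n) ℝ) {X Y : Ω → E n}
    (hX : MemLp X 2 μ) (hY : MemLp Y 2 μ) :
    crossCov (fun ω => act B (X ω)) Y μ = B * crossCov X Y μ := by
  have h := crossCov_act B 1 hX hY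
  simpa [act] using h

theorem crossCov_transpose (X Y : Ω → E n) : (crossCov X Y μ)ᵀ = crossCov Y X μ := by
  ext i j
  exact covariance_comm _ _

theorem crossCov_add_left [IsFiniteMeasure μ] {X Y Z : Ω → E n}
    (hX : MemLp X 2 μ) (hY : MemLp Y 2 μ) (hZ : MemLp Z 2 μ) :
    crossCov (fun ω => X ω + Y ω) Z μ = crossCov X Z μ + crossCov Y Z μ := by
  ext i j
  exact covariance_add_left (hX.eval_piLp i) (hY.eval_piLp i) (hZ.eval_piLp j)

theorem crossCov_add_right [IsFiniteMeasure μ] {X Y Z : Ω → E n}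
    (hX : MemLp X 2 μ) (hY : MemLp Y 2 μ) (hZ : MemLp Z 2 μ) :
    crossCov Z (fun ω => X ω + Y ω) μ = crossCov Z X μ + crossCov Z Y μ := by
  rw [← crossCov_transpose, crossCov_add_left hX hY hZ, Matrix.transpose_add, crossCov_transpose,
    crossCov_transpose]

theorem crossCov_const_left [IsProbabilityMeasure μ] (c : E n) (Y : Ω → E n) :
    crossCov (fun _ => c) Y μ = 0 := by
  ext i j
  exact covariance_const_left (c i)

theorem crossCov_map {Ω' : Type*} [MeasurableSpace Ω'] {g : Ω → Ω'} (hg : AEMeasurable g μ)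
    {X Y : Ω' → E n} (hX : Measurable X) (hY : Measurable Y) :
    crossCov X Y (μ.map g) = crossCov (fun ω => X (g ω)) (fun ω => Y (g ω)) μ := by
  ext i j
  refine covariance_map_fun (Measurable.aestronglyMeasurable ?_)
    (Measurable.aestronglyMeasurable ?_) hg <;> fun_prop

theorem crossCov_fst_snd {Ω' : Type*} [MeasurableSpace Ω'] {ν : Measure Ω'}
    [IsProbabilityMeasure μ] [IsProbabilityMeasure ν] {X : Ω → E n} {Y : Ω' → E n}
    (hX : MemLp X 2 μ) (hY : MemLp Y 2 ν) :
    crossCov (fun p : Ω × Ω' => X p.1) (fun p => Y p.2) (μ.prod ν) = 0 := by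
  ext i j
  exact covariance_fst_snd_prod (hX.eval_piLp i) (hY.eval_piLp j)

theorem crossCov_snd_fst {Ω' : Type*} [MeasurableSpace Ω'] {ν : Measure Ω'}
    [IsProbabilityMeasure μ] [IsProbabilityMeasure ν] {X : Ω → E n} {Y : Ω' → E n}
    (hX : MemLp X 2 μ) (hY : MemLp Y 2 ν) :
    crossCov (fun p : Ω × Ω' => Y p.2) (fun p => X p.1) (μ.prod ν) = 0 := by
  rw [← crossCov_transpose, crossCov_fst_snd hX hY, Matrix.transpose_zero]

theorem crossCov_fst {Ω' : Type*} [MeasurableSpace Ω'] {ν : Measure Ω'}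
    [IsProbabilityMeasure μ] [IsProbabilityMeasure ν] {X Y : Ω → E n}
    (hX : Measurable X) (hY : Measurable Y) :
    crossCov (fun p : Ω × Ω' => X p.1) (fun p => Y p.1) (μ.prod ν) = crossCov X Y μ := by
  rw [← crossCov_map (μ := μ.prod ν) (g := Prod.fst) measurable_fst.aemeasurable hX hY,
    Measure.map_fst_prod]
  simp

theorem crossCov_snd {Ω' : Type*} [MeasurableSpace Ω'] {ν : Measure Ω'}
    [IsProbabilityMeasure μ] [IsProbabilityMeasure ν] {X Y : Ω' → E n}
    (hX : Measurable X) (hY : Measurable Y) :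
    crossCov (fun p : Ω × Ω' => X p.2) (fun p => Y p.2) (μ.prod ν) = crossCov X Y ν := by
  rw [← crossCov_map (μ := μ.prod ν) (g := Prod.snd) measurable_snd.aemeasurable hX hY,
    Measure.map_snd_prod]
  simp

/-- A centred square integrable noise distribution with covariance matrix `Γ`. -/
structure IsNoise (ν : Measure (E n)) (Γ : Matrix (Fin n) (Fin n) ℝ) : Prop where
  prob : IsProbabilityMeasure ν
  memLp : MemLp (fun z : E n => z) 2 ν
  mean : ∫ z, z ∂ν = 0
  cov : crossCov (fun z : E n => z) (fun z => z) ν = Γ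

/-- The noise of zero update steps. -/
theorem IsNoise.dirac : IsNoise (Measure.dirac (0 : E n)) 0 where
  prob := inferInstance
  memLp := by
    refine MemLp.of_bound (C := 0) (by fun_prop) ?_
    rw [ae_dirac_iff (measurableSet_le (by fun_prop) (by fun_prop))]
    simp
  mean := by simp
  cov := by
    ext i j
    simp [crossCov, covariance]

theorem IsNoise.gaussian {Γ : Matrix (Fin n) (Fin n) ℝ} (hΓ : Γ.PosSemidef) :
    IsNoise (multivariateGaussian 0 Γ) Γ where
  prob := inferInstance
  memLp := IsGaussian.memLp_two_id
  mean := integral_id_multivariateGaussian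
  cov := by
    ext i j
    exact covariance_eval_multivariateGaussian hΓ i j

theorem IsNoise.act {ν : Measure (E n)} {Γ : Matrix (Fin n) (Fin n) ℝ} (h : IsNoise ν Γ)
    (B : Matrix (Fin k) (Fin n) ℝ) : IsNoise (ν.map (act B)) (B * Γ * Bᵀ) := by
  have := h.prob
  have hm : MemLp (fun z => MGMC.act B z) 2 ν := memLp_act B h.memLp
  refine ⟨Measure.isProbabilityMeasure_map (by fun_prop), ?_, ?_, ?_⟩
  · rw [memLp_map_measure_iff (by fun_prop) (by fun_prop)]
    exact hm
  · rw [integral_map (by fun_prop) (by fun_prop), integral_act B (h.memLp.integrable (by norm_num)),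
      h.mean]
    simp [MGMC.act]
  · rw [crossCov_map (by fun_prop) (by fun_prop) (by fun_prop), crossCov_act B B h.memLp h.memLp,
      h.cov]

theorem IsNoise.add {ν₁ ν₂ : Measure (E n)} {Γ₁ Γ₂ : Matrix (Fin n) (Fin n) ℝ}
    (h₁ : IsNoise ν₁ Γ₁) (h₂ : IsNoise ν₂ Γ₂) :
    IsNoise ((ν₁.prod ν₂).map fun p => p.1 + p.2) (Γ₁ + Γ₂) := by
  have := h₁.prob
  have := h₂.prob
  have l1 : MemLp (fun p : E n × E n => p.1) 2 (ν₁.prod ν₂) := h₁.memLp.comp_fst ν₂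
  have l2 : MemLp (fun p : E n × E n => p.2) 2 (ν₁.prod ν₂) := h₂.memLp.comp_snd ν₁
  have l3 : MemLp (fun p : E n × E n => p.1 + p.2) 2 (ν₁.prod ν₂) := l1.add l2
  refine ⟨Measure.isProbabilityMeasure_map (by fun_prop), ?_, ?_, ?_⟩
  · rw [memLp_map_measure_iff (by fun_prop) (by fun_prop)]
    exact l3
  · rw [integral_map (by fun_prop) (by fun_prop), integral_add (l1.integrable (by norm_num))
      (l2.integrable (by norm_num)), integral_fun_fst (fun z : E n => z),
      integral_fun_snd (fun z : E n => z), h₁.mean, h₂.mean]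
    simp
  · rw [crossCov_map (by fun_prop) (by fun_prop) (by fun_prop),
      crossCov_add_left l1 l2 l3, crossCov_add_right l1 l2 l1, crossCov_add_right l1 l2 l2,
      crossCov_fst measurable_id' measurable_id', crossCov_snd measurable_id' measurable_id',
      crossCov_fst_snd h₁.memLp h₂.memLp, crossCov_snd_fst h₁.memLp h₂.memLp, h₁.cov, h₂.cov]
    simp

end Covariance

/-! ### The multigrid update as an affine map plus noise -/

section AffineUpdate

variable {n k : ℕ}

theorem act_add (B : Matrix (Fin k) (Fin n) ℝ) (v w : E n) : act B (v + w) = act B v + act B w := by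
  simp [act, Matrix.mulVec_add]

theorem act_sub (B : Matrix (Fin k) (Fin n) ℝ) (v w : E n) : act B (v - w) = act B v - act B w := by
  simp [act, Matrix.mulVec_sub]

theorem sub_act (B C : Matrix (Fin k) (Fin n) ℝ) (v : E n) : act (B - C) v = act B v - act C v := by
  simp [act, Matrix.sub_mulVec]

theorem one_act (v : E n) : act 1 v = v := by
  simp [act]

theorem zero_act (v : E n) : act (0 : Matrix (Fin k) (Fin n) ℝ) v = 0 := by
  simp [act]

theorem act_zero (B : Matrix (Fin k) (Fin n) ℝ) : act B 0 = 0 := by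
  simp [act]

/-- `κ` is an affine random update `θ' = X θ + (1 - X) A⁻¹ f + z`, with fresh noise `z`, that leaves
the mean `A⁻¹ f` and the covariance matrix `A⁻¹` invariant. -/
def IsAffineUpdate (A X : Matrix (Fin n) (Fin n) ℝ) (κ : Kernel (E n × E n) (E n)) : Prop :=
  ∃ ν : Measure (E n), IsNoise ν (A⁻¹ - X * A⁻¹ * Xᵀ) ∧
    ∀ p, κ p = ν.map (fun z => act X p.2 + act ((1 - X) * A⁻¹) p.1 + z)

theorem isAffineUpdate_snd (A : Matrix (Fin n) (Fin n) ℝ) :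
    IsAffineUpdate A 1 (Kernel.deterministic Prod.snd measurable_snd) := by
  refine ⟨Measure.dirac 0, by simpa using IsNoise.dirac, fun p => ?_⟩
  rw [Kernel.deterministic_apply, Measure.map_dirac' (by fun_prop)]
  simp [one_act, zero_act]

/-- The composite noise is `X₂ z₁ + z₂` with independent summands. Its covariance `X₂ (A⁻¹ - X₁ A⁻¹
X₁ᵀ) X₂ᵀ + A⁻¹ - X₂ A⁻¹ X₂ᵀ` telescopes. -/
theorem IsAffineUpdate.andThen {A X₁ X₂ : Matrix (Fin n) (Fin n) ℝ}
    {κ η : Kernel (E n × E n) (E n)} [IsMarkovKernel κ] [IsMarkovKernel η]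
    (h₁ : IsAffineUpdate A X₁ κ) (h₂ : IsAffineUpdate A X₂ η) :
    IsAffineUpdate A (X₂ * X₁) (andThen κ η) := by
  obtain ⟨ν₁, hν₁, hκ⟩ := h₁
  obtain ⟨ν₂, hν₂, hη⟩ := h₂
  have := hν₁.prob
  have := hν₂.prob
  have := (hν₁.act X₂).prob
  refine ⟨_, by
    convert! (hν₁.act X₂).add hν₂ using 1
    rw [Matrix.transpose_mul]
    simp only [mul_sub, sub_mul, mul_assoc]
    abel, fun p => ?_⟩
  refine Measure.ext fun s hs => ?_
  rw [MGMC.andThen, Kernel.comp_apply' _ _ _ hs, Kernel.prod_apply, Kernel.deterministic_apply,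
    Measure.dirac_prod, lintegral_map (η.measurable_coe hs) (by fun_prop), hκ,
    lintegral_map (by
      exact (η.measurable_coe hs).comp (measurable_const.prodMk measurable_id)) (by fun_prop),
    Measure.map_apply (by fun_prop) hs, Measure.map_apply (by fun_prop)
      ((by fun_prop : Measurable fun z : E n => _) hs),
    Measure.prod_apply (by
      exact (by fun_prop : Measurable fun q : E n × E n =>
        act (X₂ * X₁) p.2 + act ((1 - X₂ * X₁) * A⁻¹) p.1 + (q.1 + q.2)) hs),
    lintegral_map (measurable_measure_prodMk_left (by
      exact (by fun_prop : Measurable fun q : E n × E n =>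
        act (X₂ * X₁) p.2 + act ((1 - X₂ * X₁) * A⁻¹) p.1 + (q.1 + q.2)) hs)) (by fun_prop)]
  refine lintegral_congr fun z => ?_
  rw [hη, Measure.map_apply (by fun_prop) hs]
  congr 1
  ext w
  simp only [Set.mem_preimage]
  refine iff_of_eq (congrArg (· ∈ s) ?_)
  simp only [act_add, act_sub, sub_act, act_act, sub_mul, one_mul, mul_assoc]
  abel

theorem IsAffineUpdate.repeated {A X : Matrix (Fin n) (Fin n) ℝ}
    {κ : Kernel (E n × E n) (E n)} [IsMarkovKernel κ] (h : IsAffineUpdate A X κ) (j : ℕ) :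
    IsAffineUpdate A (X ^ j) (repeated κ j) := by
  induction j with
  | zero =>
    rw [pow_zero]
    exact isAffineUpdate_snd A
  | succ j ih =>
    rw [pow_succ']
    exact ih.andThen h

/-- The choice `M + Mᵀ - A` of the noise covariance is what makes `A⁻¹` invariant: for symmetric
`M`, both sides are `2 M⁻¹ - M⁻¹ A M⁻¹`. It is positive semidefinite as the sum of `M` and `M - A`.
-/
theorem isAffineUpdate_randomSmoother {A M : Matrix (Fin n) (Fin n) ℝ} (hA : A.PosDef)
    (hMt : Mᵀ = M) (hAM : A ≤ M) :
    IsAffineUpdate A (1 - M⁻¹ * A) (randomSmoother A M) := by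
  have hM : M.PosDef := by
    have := hA.add_posSemidef (Matrix.le_iff.1 hAM)
    rwa [add_sub_cancel] at this
  have hAt : Aᵀ = A := by
    rw [← Matrix.conjTranspose_eq_transpose_of_trivial]; exact hA.isHermitian.eq
  have hi : A * A⁻¹ = 1 :=
    Matrix.mul_nonsing_inv _ ((Matrix.isUnit_iff_isUnit_det _).1 hA.isUnit)
  have hi' : A⁻¹ * A = 1 :=
    Matrix.nonsing_inv_mul _ ((Matrix.isUnit_iff_isUnit_det _).1 hA.isUnit)
  have hm : M⁻¹ * M = 1 :=
    Matrix.nonsing_inv_mul _ ((Matrix.isUnit_iff_isUnit_det _).1 hM.isUnit)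
  have hΓ : (M + Mᵀ - A).PosSemidef := by
    have := hM.posSemidef.add (Matrix.le_iff.1 hAM)
    rwa [hMt, add_sub_assoc]
  have := (IsNoise.gaussian hΓ).prob
  refine ⟨_, by
    convert! (IsNoise.gaussian hΓ).act M⁻¹ using 1
    rw [Matrix.transpose_sub, Matrix.transpose_mul, Matrix.transpose_nonsing_inv, hMt, hAt,
      Matrix.transpose_one]
    have e1 : M⁻¹ * A * A⁻¹ = M⁻¹ := by rw [mul_assoc, hi, mul_one]
    have e2 : A⁻¹ * (A * M⁻¹) = M⁻¹ := by rw [← mul_assoc, hi', one_mul]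
    simp only [mul_sub, sub_mul, mul_add, add_mul, mul_one, one_mul, e1, e2, hm]
    simp only [← mul_assoc]
    abel, fun p => ?_⟩
  rw [randomSmoother, Kernel.map_apply _ (by fun_prop), Kernel.prod_apply, Kernel.id_apply,
    Kernel.const_apply, Measure.dirac_prod, Measure.map_map (by fun_prop) (by fun_prop),
    Measure.map_map (by fun_prop) (by fun_prop)]
  congr 1
  funext z
  simp only [Function.comp, act_add, act_sub, sub_act, act_act, one_act, sub_sub_cancel, mul_assoc,
    hi, mul_one]
  abel

theorem isAffineUpdate_exactSampler {A : Matrix (Fin n) (Fin n) ℝ} (hA : A.PosDef) :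
    IsAffineUpdate A 0 (exactSampler A) := by
  refine ⟨_, by simpa using IsNoise.gaussian hA.inv.posSemidef, fun p => ?_⟩
  rw [exactSampler, Kernel.map_apply _ (by fun_prop), Kernel.prod_apply, Kernel.id_apply,
    Kernel.const_apply, Measure.dirac_prod, Measure.map_map (by fun_prop) (by fun_prop)]
  congr 1
  funext z
  simp [zero_act]

/-- Put `Y = (1 - X) Ac⁻¹` and `Z = P Y Pᵀ`. The coarse noise covariance is `Y + Yᵀ - Y Ac Yᵀ`, and
the Galerkin condition makes its image under `P` equal to `Z + Zᵀ - Z A Zᵀ`. This is the covariance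
required on the fine level for the iteration matrix `1 - Z A`. -/
theorem IsAffineUpdate.coarseCorrection {A : Matrix (Fin n) (Fin n) ℝ}
    {P : Matrix (Fin n) (Fin k) ℝ} {Ac X : Matrix (Fin k) (Fin k) ℝ}
    {κ : Kernel (E k × E k) (E k)} [IsMarkovKernel κ] (hA : A.PosDef) (hAc : Ac.PosDef)
    (hG : Ac = Pᵀ * A * P) (h : IsAffineUpdate Ac X κ) :
    IsAffineUpdate A (correctionMatrix A P Ac X) (coarseCorrection A P 1 κ) := by
  obtain ⟨ν, hν, hκ⟩ := h.repeated 1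
  rw [pow_one] at hν hκ
  have := hν.prob
  have hAt : Aᵀ = A := by
    rw [← Matrix.conjTranspose_eq_transpose_of_trivial]; exact hA.isHermitian.eq
  have hAct : Acᵀ = Ac := by
    rw [← Matrix.conjTranspose_eq_transpose_of_trivial]; exact hAc.isHermitian.eq
  have hi : A * A⁻¹ = 1 :=
    Matrix.mul_nonsing_inv _ ((Matrix.isUnit_iff_isUnit_det _).1 hA.isUnit)
  have hi' : A⁻¹ * A = 1 :=
    Matrix.nonsing_inv_mul _ ((Matrix.isUnit_iff_isUnit_det _).1 hA.isUnit)
  have hc : Ac⁻¹ * Ac = 1 :=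
    Matrix.nonsing_inv_mul _ ((Matrix.isUnit_iff_isUnit_det _).1 hAc.isUnit)
  obtain ⟨Y, hY⟩ : ∃ Y, Y = (1 - X) * Ac⁻¹ := ⟨_, rfl⟩
  have hXY : X = 1 - Y * Ac := by rw [hY, mul_assoc, hc, mul_one, sub_sub_cancel]
  have hcov : Ac⁻¹ - X * Ac⁻¹ * Xᵀ = Y + Yᵀ - Y * Ac * Yᵀ := by
    have hc' : Ac * Ac⁻¹ = 1 :=
      Matrix.mul_nonsing_inv _ ((Matrix.isUnit_iff_isUnit_det _).1 hAc.isUnit)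
    have e2 : Ac⁻¹ * (Ac * Yᵀ) = Yᵀ := by rw [← mul_assoc, hc, one_mul]
    rw [hXY, Matrix.transpose_sub, Matrix.transpose_mul, Matrix.transpose_one, hAct]
    simp only [mul_sub, sub_mul, mul_one, one_mul, mul_assoc, hc', e2]
    abel
  rw [hcov] at hν
  refine ⟨_, by
    convert! hν.act P using 1
    rw [correctionMatrix, ← hY, hG, Matrix.transpose_sub, Matrix.transpose_mul,
      Matrix.transpose_mul, Matrix.transpose_mul, Matrix.transpose_transpose, hAt,
      Matrix.transpose_one]
    have e1 : P * Y * Pᵀ * A * A⁻¹ = P * Y * Pᵀ := by rw [Matrix.mul_assoc, hi, Matrix.mul_one]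
    have e2 : A⁻¹ * (A * (P * (Yᵀ * Pᵀ))) = P * (Yᵀ * Pᵀ) := by
      rw [← Matrix.mul_assoc, hi', Matrix.one_mul]
    simp only [Matrix.mul_sub, Matrix.sub_mul, Matrix.mul_add, Matrix.add_mul, Matrix.mul_one,
      Matrix.one_mul, e1, e2]
    simp only [Matrix.mul_assoc]
    abel, fun p => ?_⟩
  rw [MGMC.coarseCorrection, Kernel.map_apply _ (by fun_prop), Kernel.prod_apply, Kernel.id_apply,
    Kernel.comap_apply, hκ, Measure.dirac_prod, Measure.map_map (by fun_prop) (by fun_prop),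
    Measure.map_map (by fun_prop) (by fun_prop), Measure.map_map (by fun_prop) (by fun_prop)]
  congr 1
  funext z
  simp only [Function.comp, correctionMatrix, ← hY, act_add, act_sub, sub_act, act_act, one_act,
    act_zero, sub_sub_cancel, Matrix.mul_assoc, hi, Matrix.mul_one]
  abel

theorem isAffineUpdate_mgmc {n : ℕ → ℕ} {A : (ℓ : ℕ) → Matrix (Fin (n ℓ)) (Fin (n ℓ)) ℝ}
    {P : (ℓ : ℕ) → Matrix (Fin (n (ℓ + 1))) (Fin (n ℓ)) ℝ}
    {M : (ℓ : ℕ) → Matrix (Fin (n ℓ)) (Fin (n ℓ)) ℝ} {L : ℕ} (j : ℕ)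
    (hA : ∀ ℓ ≤ L, (A ℓ).PosDef)
    (hG : ∀ ℓ < L, A ℓ = (P ℓ)ᵀ * A (ℓ + 1) * P ℓ)
    (hS : ∀ ℓ < L, SmoothingProperty (A (ℓ + 1)) (M (ℓ + 1))) :
    ∀ ℓ ≤ L, IsAffineUpdate (A ℓ) (cycleMatrix n A P M j ℓ)
      (mgmc n A P M M j j (fun _ => 1) (exactSampler (A 0)) ℓ) := by
  intro ℓ
  induction ℓ with
  | zero => exact fun h => isAffineUpdate_exactSampler (hA 0 h)
  | succ ℓ ih =>
    intro hl
    have hs := (isAffineUpdate_randomSmoother (hA _ hl) (hS ℓ hl).1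
      (Matrix.le_iff.2 (hS ℓ hl).2.2)).repeated j
    exact (hs.andThen ((ih (by omega)).coarseCorrection (hA _ hl) (hA ℓ (by omega))
      (hG ℓ hl))).andThen hs

end AffineUpdate

/-! ### Moments after one affine random step -/

section Chain

variable {Ω S : Type*} [MeasurableSpace Ω] [MeasurableSpace S] {μ : Measure Ω}
  [IsProbabilityMeasure μ] {n : ℕ} {Y : Ω → E n} {Z : Ω → S} {κ : Kernel S (E n)}
  [IsMarkovKernel κ] {ν : Measure (E n)} {X Γ : Matrix (Fin n) (Fin n) ℝ} {c : E n} {g : S → E n}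

/-- Realises the conditional law on a product space, where the noise is a coordinate independent of
`Z`; all moments are computed there. -/
theorem map_eq_of_affine (h : HasCondDistrib Y Z κ μ) (hν : IsNoise ν Γ) (hg : Measurable g)
    (hκ : ∀ s, κ s = ν.map (fun z => act X (g s) + c + z)) :
    μ.map (fun ω => (Z ω, Y ω)) =
      ((μ.map Z).prod ν).map (fun p => (p.1, act X (g p.1) + c + p.2)) := by
  have := hν.prob
  have := Measure.isProbabilityMeasure_map h.aemeasurable_fst
  have hm : Measurable fun p : S × E n => (p.1, act X (g p.1) + c + p.2) := by fun_prop
  refine Measure.ext fun s hs => ?_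
  rw [h.map_eq, Measure.compProd_apply hs, Measure.map_apply hm hs, Measure.prod_apply (hm hs)]
  refine lintegral_congr fun w => ?_
  rw [hκ, Measure.map_apply (by fun_prop) (measurable_prodMk_left hs)]
  rfl

/-- `Z` is meant to be the whole history and `g` its last state. The free function `u` lets the
cross-covariance with any earlier state be read off, because the fresh noise is uncorrelated with
everything in the history. -/
theorem moments_of_affine (h : HasCondDistrib Y Z κ μ) (hν : IsNoise ν Γ) (hg : Measurable g)
    (hκ : ∀ s, κ s = ν.map (fun z => act X (g s) + c + z))
    (hgZ : MemLp (fun ω => g (Z ω)) 2 μ) :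
    MemLp Y 2 μ ∧ ∫ ω, Y ω ∂μ = act X (∫ ω, g (Z ω) ∂μ) + c ∧
      crossCov Y Y μ = X * crossCov (fun ω => g (Z ω)) (fun ω => g (Z ω)) μ * Xᵀ + Γ ∧
      ∀ u : S → E n, Measurable u → MemLp (fun ω => u (Z ω)) 2 μ →
        crossCov Y (fun ω => u (Z ω)) μ =
          X * crossCov (fun ω => g (Z ω)) (fun ω => u (Z ω)) μ := by
  have := hν.prob
  have hZ := h.aemeasurable_fst
  have hY := h.aemeasurable_snd
  have := Measure.isProbabilityMeasure_map hZ
  set π := μ.map Z with hπ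
  have hlaw := map_eq_of_affine h hν hg hκ
  rw [← hπ] at hlaw
  set Φ : S × E n → S × E n := fun p => (p.1, act X (g p.1) + c + p.2) with hΦ
  have hΦm : Measurable Φ := by fun_prop
  have hgπ : MemLp g 2 π := by
    rw [hπ, memLp_map_measure_iff (by fun_prop) hZ]
    exact hgZ
  have l1 : MemLp (fun p : S × E n => act X (g p.1)) 2 (π.prod ν) :=
    (memLp_act X hgπ).comp_fst ν
  have lc : MemLp (fun _ : S × E n => c) 2 (π.prod ν) := memLp_const c
  have l1c : MemLp (fun p : S × E n => act X (g p.1) + c) 2 (π.prod ν) := l1.add lc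
  have l2 : MemLp (fun p : S × E n => p.2) 2 (π.prod ν) := hν.memLp.comp_snd π
  have l3 : MemLp (fun p : S × E n => act X (g p.1) + c + p.2) 2 (π.prod ν) := l1c.add l2
  have hcov : ∀ a b : S × E n → E n, Measurable a → Measurable b →
      crossCov (fun ω => a (Z ω, Y ω)) (fun ω => b (Z ω, Y ω)) μ =
        crossCov (fun p => a (Φ p)) (fun p => b (Φ p)) (π.prod ν) := by
    intro a b ha hb
    rw [← crossCov_map (g := fun ω => (Z ω, Y ω)) (hZ.prodMk hY) ha hb, hlaw,
      crossCov_map hΦm.aemeasurable ha hb]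
  have hgg : crossCov g g π = crossCov (fun ω => g (Z ω)) (fun ω => g (Z ω)) μ :=
    crossCov_map hZ hg hg
  have hM : Measurable fun s => act X (g s) := by fun_prop
  have hsplit : ∀ W : S × E n → E n, MemLp W 2 (π.prod ν) →
      crossCov (fun p : S × E n => act X (g p.1) + c + p.2) W (π.prod ν) =
        crossCov (fun p : S × E n => act X (g p.1)) W (π.prod ν) +
          crossCov (fun p : S × E n => p.2) W (π.prod ν) := by
    intro W hW
    rw [crossCov_add_left l1c l2 hW, crossCov_add_left l1 lc hW, crossCov_const_left, add_zero]
  refine ⟨?_, ?_, ?_, ?_⟩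
  · have hs : MemLp (fun p : S × E n => p.2) 2 (μ.map fun ω => (Z ω, Y ω)) := by
      rw [hlaw, memLp_map_measure_iff (by fun_prop) hΦm.aemeasurable]
      exact l3
    rwa [memLp_map_measure_iff (by fun_prop) (hZ.prodMk hY)] at hs
  · have hs : ∫ p, p.2 ∂(μ.map fun ω => (Z ω, Y ω)) = ∫ ω, Y ω ∂μ :=
      integral_map (hZ.prodMk hY) (by fun_prop)
    rw [← hs, hlaw, integral_map hΦm.aemeasurable (by fun_prop)]
    simp only [hΦ]
    rw [integral_add (l1c.integrable (by norm_num)) (l2.integrable (by norm_num)),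
      integral_add (l1.integrable (by norm_num)) (lc.integrable (by norm_num)),
      integral_fun_fst (fun s => act X (g s)), integral_fun_snd (fun z : E n => z), hν.mean,
      integral_act X (hgπ.integrable (by norm_num)), hπ, integral_map hZ (by fun_prop)]
    simp
  · have h1 := hcov Prod.snd Prod.snd measurable_snd measurable_snd
    have h1' : crossCov Y Y μ = _ := h1
    have hsplitr : ∀ W : S × E n → E n, MemLp W 2 (π.prod ν) →
        crossCov W (fun p : S × E n => act X (g p.1) + c + p.2) (π.prod ν) =
          crossCov W (fun p : S × E n => act X (g p.1)) (π.prod ν) +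
            crossCov W (fun p : S × E n => p.2) (π.prod ν) := by
      intro W hW
      rw [← crossCov_transpose, hsplit W hW, Matrix.transpose_add, crossCov_transpose,
        crossCov_transpose]
    rw [h1']
    simp only [hΦ]
    rw [hsplit _ l3, hsplitr _ l1, hsplitr _ l2, crossCov_fst_snd (memLp_act X hgπ) hν.memLp,
      crossCov_snd_fst (memLp_act X hgπ) hν.memLp, crossCov_snd measurable_id' measurable_id',
      crossCov_fst hM hM, crossCov_act X X hgπ hgπ, hgg, hν.cov, add_zero, zero_add]
  · intro u hu huZ
    have huπ : MemLp u 2 π := by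
      rw [hπ, memLp_map_measure_iff (by fun_prop) hZ]
      exact huZ
    have h1 : crossCov Y (fun ω => u (Z ω)) μ = _ :=
      hcov Prod.snd (fun p => u p.1) measurable_snd (hu.comp measurable_fst)
    rw [h1]
    simp only [hΦ]
    rw [hsplit _ (huπ.comp_fst ν), crossCov_snd_fst huπ hν.memLp, crossCov_fst hM hu,
      crossCov_act_left X hgπ huπ, hπ, crossCov_map hZ hg hu, add_zero]

end Chain

/-! ### Recursions for the mean and the covariances of the chain -/

section MarkovChain

variable {Ω : Type*} [MeasurableSpace Ω] {μ : Measure Ω} [IsProbabilityMeasure μ] {n : ℕ}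
  {A X : Matrix (Fin n) (Fin n) ℝ} {κ : Kernel (E n × E n) (E n)} [IsMarkovKernel κ] {f : E n}
  {θ : ℕ → Ω → E n}

theorem IsAffineUpdate.chain_step (hκ : IsAffineUpdate A X κ)
    (hθ : IsMarkovChain (withRhs κ f) θ μ) (m : ℕ) (hm : MemLp (θ m) 2 μ) :
    MemLp (θ (m + 1)) 2 μ ∧
      μ[θ (m + 1)] = act X μ[θ m] + act ((1 - X) * A⁻¹) f ∧
      crossCov (θ (m + 1)) (θ (m + 1)) μ =
        X * crossCov (θ m) (θ m) μ * Xᵀ + (A⁻¹ - X * A⁻¹ * Xᵀ) ∧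
      ∀ j ≤ m, MemLp (θ j) 2 μ →
        crossCov (θ (m + 1)) (θ j) μ = X * crossCov (θ m) (θ j) μ := by
  obtain ⟨ν, hν, h⟩ := hκ
  have key := moments_of_affine (X := X) (c := act ((1 - X) * A⁻¹) f)
    (g := fun s : Fin (m + 1) → E n => s (Fin.last m)) (hθ m) hν (by fun_prop)
    (fun s => by rw [Kernel.comap_apply, withRhs, Kernel.comap_apply, h])
    (by simpa using hm)
  simp only [Fin.val_last] at key
  refine ⟨key.1, key.2.1, key.2.2.1, fun j hj hjm => ?_⟩
  exact key.2.2.2 (fun s => s ⟨j, by omega⟩) (by fun_prop) hjm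

theorem IsAffineUpdate.chain_memLp (hκ : IsAffineUpdate A X κ)
    (hθ : IsMarkovChain (withRhs κ f) θ μ) (h0 : MemLp (θ 0) 2 μ) (m : ℕ) : MemLp (θ m) 2 μ := by
  induction m with
  | zero => exact h0
  | succ m ih => exact (hκ.chain_step hθ m ih).1

theorem IsAffineUpdate.chain_mean (hκ : IsAffineUpdate A X κ)
    (hθ : IsMarkovChain (withRhs κ f) θ μ) (h0 : MemLp (θ 0) 2 μ) (m : ℕ) :
    μ[θ (m + 1)] - act A⁻¹ f = act X (μ[θ m] - act A⁻¹ f) := by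
  rw [(hκ.chain_step hθ m (hκ.chain_memLp hθ h0 m)).2.1]
  simp only [act_sub, sub_act, act_act, sub_mul, one_mul]
  abel

theorem IsAffineUpdate.chain_cov (hκ : IsAffineUpdate A X κ)
    (hθ : IsMarkovChain (withRhs κ f) θ μ) (h0 : MemLp (θ 0) 2 μ) (m : ℕ) :
    crossCov (θ (m + 1)) (θ (m + 1)) μ - A⁻¹ = X * (crossCov (θ m) (θ m) μ - A⁻¹) * Xᵀ := by
  rw [(hκ.chain_step hθ m (hκ.chain_memLp hθ h0 m)).2.2.1]
  simp only [mul_sub, sub_mul]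
  abel

theorem IsAffineUpdate.chain_crossCov (hκ : IsAffineUpdate A X κ)
    (hθ : IsMarkovChain (withRhs κ f) θ μ) (h0 : MemLp (θ 0) 2 μ) (m s : ℕ) :
    crossCov (θ (m + s)) (θ m) μ = X ^ s * crossCov (θ m) (θ m) μ := by
  induction s with
  | zero => simp
  | succ s ih =>
    rw [← add_assoc, (hκ.chain_step hθ (m + s) (hκ.chain_memLp hθ h0 _)).2.2.2 m (by omega)
      (hκ.chain_memLp hθ h0 m), ih, pow_succ', mul_assoc]

end MarkovChain

/-! ### Contraction estimates and the asymptotic rate -/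

section Convergence

variable {n : ℕ} {A X T : Matrix (Fin n) (Fin n) ℝ} {η : ℝ}

theorem vecEnergyNorm_act_le (hA : A.PosDef) (hT : ‖T‖ ≤ η)
    (hX : CFC.sqrt A * X = T * CFC.sqrt A) (v : E n) :
    vecEnergyNorm A (act X v) ≤ η * vecEnergyNorm A v := by
  rw [vecEnergyNorm_eq hA, vecEnergyNorm_eq hA, act_act, hX, ← act_act]
  exact (norm_act_le T _).trans (mul_le_mul_of_nonneg_right hT (norm_nonneg _))

theorem energyNorm_pow_mul_le (hT : ‖T‖ ≤ η) (hX : CFC.sqrt A * X = T * CFC.sqrt A) (s : ℕ)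
    (B : Matrix (Fin n) (Fin n) ℝ) : energyNorm A (X ^ s * B) ≤ η ^ s * energyNorm A B := by
  have h := norm_pow_le_pow hT s (CFC.sqrt A * B * (CFC.sqrt A)⁻¹)
  rw [energyNorm, energyNorm, ← mul_assoc, intertwine_pow hX]
  simpa only [mul_assoc] using h

theorem sqrt_mul_sub_one (hA : A.PosDef) (C : Matrix (Fin n) (Fin n) ℝ) :
    CFC.sqrt A * C * CFC.sqrt A - 1 = CFC.sqrt A * (C - A⁻¹) * CFC.sqrt A := by
  obtain ⟨hRR, -, hRu⟩ := hA.sqrt_facts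
  have hi : A⁻¹ = (CFC.sqrt A)⁻¹ * (CFC.sqrt A)⁻¹ := by
    rw [← Matrix.mul_inv_rev, hRR]
  rw [mul_sub, sub_mul, hi, ← mul_assoc, Matrix.mul_nonsing_inv _ hRu, one_mul,
    Matrix.nonsing_inv_mul _ hRu]

/-- Symmetry of `T` turns the transposed intertwining relation into `Xᵀ A^{1/2} = A^{1/2} T`, so the
same `T` acts on both sides; this is the source of the square in the covariance rate. -/
theorem scaled_conj (hA : A.PosDef) (hTt : Tᵀ = T)
    (hX : CFC.sqrt A * X = T * CFC.sqrt A) (K : Matrix (Fin n) (Fin n) ℝ) :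
    CFC.sqrt A * (X * K * Xᵀ) * CFC.sqrt A = T * (CFC.sqrt A * K * CFC.sqrt A) * T := by
  obtain ⟨-, hRt, -⟩ := hA.sqrt_facts
  have h : Xᵀ * CFC.sqrt A = CFC.sqrt A * T := by
    have := congrArg Matrix.transpose hX
    rwa [Matrix.transpose_mul, Matrix.transpose_mul, hRt, hTt] at this
  calc _ = (CFC.sqrt A * X) * K * (Xᵀ * CFC.sqrt A) := by simp only [mul_assoc]
    _ = _ := by rw [h, hX]; simp only [mul_assoc]

theorem scaled_recursion {D : ℕ → Matrix (Fin n) (Fin n) ℝ} (h : ∀ m, D (m + 1) = T * D m * T)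
    (m : ℕ) : D m = T ^ m * D 0 * T ^ m := by
  induction m with
  | zero => simp
  | succ m ih =>
    rw [h, ih]
    calc _ = (T * T ^ m) * D 0 * (T ^ m * T) := by simp only [mul_assoc]
      _ = _ := by rw [← pow_succ', ← pow_succ]

/-- Separates the symmetric scaling, which evolves by `D ↦ T D T`, from a fixed invertible factor
`A⁻¹` that cannot affect the rate. -/
theorem energyNorm_eq (hA : A.PosDef) (K : Matrix (Fin n) (Fin n) ℝ) :
    energyNorm A K = ‖CFC.sqrt A * K * CFC.sqrt A * A⁻¹‖ := by
  obtain ⟨hRR, -, hRu⟩ := hA.sqrt_facts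
  have hi : A⁻¹ = (CFC.sqrt A)⁻¹ * (CFC.sqrt A)⁻¹ := by
    rw [← Matrix.mul_inv_rev, hRR]
  rw [energyNorm, hi, ← mul_assoc, mul_assoc (CFC.sqrt A * K), Matrix.mul_nonsing_inv _ hRu,
    mul_one]

theorem exists_rate (hA : A.PosDef) (hTt : Tᵀ = T) (hT : ‖T‖ ≤ η)
    (hX : CFC.sqrt A * X = T * CFC.sqrt A) {K : ℕ → Matrix (Fin n) (Fin n) ℝ}
    (hK : ∀ m, K (m + 1) = X * K m * Xᵀ) (hK0 : K 0 ≠ 0) :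
    ∃ r : ℝ, r ≤ η ^ 2 ∧ Tendsto
      (fun m : ℕ => (energyNorm A (K m) / energyNorm A (K 0)) ^ (1 / (m : ℝ))) atTop (𝓝 r) := by
  obtain ⟨hRR, -, hRu⟩ := hA.sqrt_facts
  have hη : 0 ≤ η := (norm_nonneg T).trans hT
  have hAu : IsUnit A.det := (Matrix.isUnit_iff_isUnit_det _).1 hA.isUnit
  set R := CFC.sqrt A with hR
  have hi1 : R⁻¹ * R = 1 := Matrix.nonsing_inv_mul R hRu
  have hi2 : R * R⁻¹ = 1 := Matrix.mul_nonsing_inv R hRu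
  obtain ⟨D, hD⟩ : ∃ D : ℕ → Matrix (Fin n) (Fin n) ℝ, ∀ m, D m = R * K m * R := ⟨_, fun _ => rfl⟩
  have hDK : ∀ m, R⁻¹ * D m * R⁻¹ = K m := by
    intro m
    calc _ = (R⁻¹ * R) * K m * (R * R⁻¹) := by rw [hD]; simp only [mul_assoc]
      _ = _ := by rw [hi1, hi2, one_mul, mul_one]
  have hD0 : D 0 ≠ 0 := by
    intro h
    apply hK0
    rw [← hDK, h]; simp
  have hDm : ∀ m, D m = T ^ m * D 0 * T ^ m := scaled_recursion fun m => by
    rw [hD, hD, hK, scaled_conj hA hTt hX]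
  obtain ⟨ρ, c₁, c₂, hρ, hc₁, hb⟩ := exists_geometric_bounds (Z := A⁻¹) hTt hD0
    ((Matrix.isUnit_nonsing_inv_det_iff).2 hAu)
  have hE : ∀ m, energyNorm A (K m) = ‖T ^ m * D 0 * T ^ m * A⁻¹‖ := by
    intro m
    rw [energyNorm_eq hA, ← hR, ← hD, hDm]
  have hE0 : 0 < energyNorm A (K 0) := by
    -- The lower geometric bound at `m = 0` shows that the denominator does not vanish.
    have := (hb 0).1
    rw [← hE, pow_zero, mul_one] at this
    linarith
  have hlim := tendsto_root_of_bounds (a := fun m => energyNorm A (K m) / energyNorm A (K 0))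
    (c₁ := c₁ / energyNorm A (K 0)) (c₂ := c₂ / energyNorm A (K 0)) hρ (by positivity)
    (fun m => by
      rw [div_mul_eq_mul_div, hE m]
      exact div_le_div_of_nonneg_right (hb m).1 hE0.le)
    (fun m => by
      rw [div_mul_eq_mul_div, hE m]
      exact div_le_div_of_nonneg_right (hb m).2 hE0.le)
  refine ⟨ρ, ?_, hlim⟩
  have hup : ∀ m, energyNorm A (K m) ≤ (‖D 0‖ * ‖A⁻¹‖ + 1) * (η ^ 2) ^ m := by
    intro m
    have hTm : ‖D 0 * T ^ m‖ ≤ ‖D 0‖ * η ^ m := by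
      have h1 := norm_pow_le_pow hT m (D 0)ᵀ
      have h2 : ‖D 0 * T ^ m‖ = ‖T ^ m * (D 0)ᵀ‖ := by
        rw [← Matrix.l2_opNorm_conjTranspose, Matrix.conjTranspose_eq_transpose_of_trivial,
          Matrix.transpose_mul, Matrix.transpose_pow, hTt]
      have h3 : ‖(D 0)ᵀ‖ = ‖D 0‖ := by
        rw [← Matrix.conjTranspose_eq_transpose_of_trivial, Matrix.l2_opNorm_conjTranspose]
      rw [h2]
      rw [h3] at h1
      linarith
    rw [hE, mul_assoc, mul_assoc]
    calc ‖T ^ m * (D 0 * (T ^ m * A⁻¹))‖ ≤ η ^ m * ‖D 0 * (T ^ m * A⁻¹)‖ := norm_pow_le_pow hT m _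
      _ ≤ η ^ m * (‖D 0 * T ^ m‖ * ‖A⁻¹‖) := by
        rw [← mul_assoc (D 0)]
        gcongr
        exact norm_mul_le _ _
      _ ≤ η ^ m * (‖D 0‖ * η ^ m * ‖A⁻¹‖) := by gcongr
      _ = (‖D 0‖ * ‖A⁻¹‖) * (η ^ 2) ^ m := by ring
      _ ≤ _ := by gcongr; linarith
  -- If `ρ > η ^ 2`, the lower bound `c₁ ρ ^ m` and the upper bound by a multiple of `(η ^ 2) ^ m`
  -- would force `c₁ ≤ 0` in the limit.
  by_contra! hlt
  have h1 : Tendsto (fun m : ℕ => (η ^ 2 / ρ) ^ m) atTop (𝓝 0) :=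
    tendsto_pow_atTop_nhds_zero_of_lt_one (by positivity)
      ((div_lt_one (lt_of_le_of_lt (by positivity) hlt)).2 hlt)
  have hρ' : 0 < ρ := lt_of_le_of_lt (by positivity) hlt
  have h2 : ∀ m : ℕ, c₁ ≤ (‖D 0‖ * ‖A⁻¹‖ + 1) * (η ^ 2 / ρ) ^ m := by
    intro m
    rw [div_pow, mul_div_assoc', le_div_iff₀ (by positivity)]
    exact (hE m ▸ (hb m).1).trans (hup m)
  have h3 := ge_of_tendsto' (h1.const_mul (‖D 0‖ * ‖A⁻¹‖ + 1)) h2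
  rw [mul_zero] at h3
  linarith

theorem norm_conj_le (hT : ‖T‖ ≤ η) (D : Matrix (Fin n) (Fin n) ℝ) :
    ‖T * D * T‖ ≤ η ^ 2 * ‖D‖ := by
  have hη : 0 ≤ η := (norm_nonneg T).trans hT
  calc ‖T * D * T‖ ≤ ‖T‖ * ‖D‖ * ‖T‖ :=
        (norm_mul_le _ _).trans (mul_le_mul_of_nonneg_right (norm_mul_le _ _) (norm_nonneg _))
    _ ≤ η * ‖D‖ * η := by gcongr
    _ = _ := by ring

end Convergence

end MGMC

theorem mainTheorem3
    (C_A : ℝ) (hC : 0 < C_A) (ν : ℕ) (hν : 0 < ν) (hνeven : Even ν)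
    (L : ℕ) (n : ℕ → ℕ)
    (A : (ℓ : ℕ) → Matrix (Fin (n ℓ)) (Fin (n ℓ)) ℝ)
    (P : (ℓ : ℕ) → Matrix (Fin (n (ℓ + 1))) (Fin (n ℓ)) ℝ)
    (M : (ℓ : ℕ) → Matrix (Fin (n ℓ)) (Fin (n ℓ)) ℝ)
    (hA : ∀ ℓ ≤ L, (A ℓ).PosDef)
    (hGalerkin : ∀ ℓ < L, A ℓ = (P ℓ)ᵀ * A (ℓ + 1) * P ℓ)
    (hSmooth : ∀ ℓ < L, MGMC.SmoothingProperty (A (ℓ + 1)) (M (ℓ + 1)))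
    (hApprox : MGMC.ApproximationProperty n A P M L C_A)
    (f : MGMC.E (n L))
    {Ω : Type*} [MeasurableSpace Ω] (μ : Measure Ω) [IsProbabilityMeasure μ]
    (θ : ℕ → Ω → MGMC.E (n L))
    (hθ₀ : MemLp (θ 0) 2 μ)
    (hθ : MGMC.IsMarkovChain
      (MGMC.withRhs
        (MGMC.mgmc n A P M M (ν / 2) (ν / 2) (fun _ => 1) (MGMC.exactSampler (A 0)) L) f) θ μ) :
    (∀ m : ℕ, MemLp (θ m) 2 μ) ∧
    (∀ m : ℕ, MGMC.vecEnergyNorm (A L) (μ[θ (m + 1)] - MGMC.act (A L)⁻¹ f) ≤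
      C_A / (C_A + ν) * MGMC.vecEnergyNorm (A L) (μ[θ m] - MGMC.act (A L)⁻¹ f)) ∧
    (∀ m : ℕ,
      ‖CFC.sqrt (A L) * MGMC.crossCov (θ (m + 1)) (θ (m + 1)) μ * CFC.sqrt (A L) - 1‖ ≤
        (C_A / (C_A + ν)) ^ 2 *
          ‖CFC.sqrt (A L) * MGMC.crossCov (θ m) (θ m) μ * CFC.sqrt (A L) - 1‖) ∧
    (∀ m : ℕ,
      ‖CFC.sqrt (A L) * MGMC.crossCov (θ m) (θ m) μ * CFC.sqrt (A L) - 1‖ ≤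
        (C_A / (C_A + ν)) ^ (2 * m) *
          ‖CFC.sqrt (A L) * MGMC.crossCov (θ 0) (θ 0) μ * CFC.sqrt (A L) - 1‖) ∧
    (∀ m s : ℕ, MGMC.energyNorm (A L) (MGMC.crossCov (θ (m + s)) (θ m) μ) ≤
      (C_A / (C_A + ν)) ^ s * MGMC.energyNorm (A L) (MGMC.crossCov (θ m) (θ m) μ)) ∧
    (MGMC.crossCov (θ 0) (θ 0) μ ≠ (A L)⁻¹ →
      ∃ r : ℝ, r ≤ (C_A / (C_A + ν)) ^ 2 ∧
        Tendsto (fun m : ℕ =>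
          (MGMC.energyNorm (A L) (MGMC.crossCov (θ m) (θ m) μ - (A L)⁻¹) /
            MGMC.energyNorm (A L) (MGMC.crossCov (θ 0) (θ 0) μ - (A L)⁻¹)) ^ (1 / (m : ℝ)))
          atTop (𝓝 r)) := by
  obtain ⟨j, hj⟩ := hνeven
  have hj2 : ν / 2 = j := by omega
  -- With `j` smoothing steps on either side of the correction, the constant `c / (c + 2 j)` of the
  -- V-cycle bound becomes `C_A / (C_A + ν)`.
  have hνj : 2 * j = ν := by omega
  rw [hj2] at hθ
  have hAL := hA L le_rfl
  have hη : 0 ≤ C_A / (C_A + ν) := by positivity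
  obtain ⟨hX0, hX1⟩ := MGMC.cycleMatrix_bounds hC j hA hGalerkin hSmooth hApprox L le_rfl
  rw [hνj] at hX1
  obtain ⟨T, hTt, hT, hX⟩ := MGMC.exists_symm_similar hAL hη hX0 hX1
  have hκ := MGMC.isAffineUpdate_mgmc (M := M) j hA hGalerkin hSmooth L le_rfl
  have hstep : ∀ m : ℕ,
      ‖CFC.sqrt (A L) * MGMC.crossCov (θ (m + 1)) (θ (m + 1)) μ * CFC.sqrt (A L) - 1‖ ≤
        (C_A / (C_A + ν)) ^ 2 *
          ‖CFC.sqrt (A L) * MGMC.crossCov (θ m) (θ m) μ * CFC.sqrt (A L) - 1‖ := by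
    intro m
    rw [MGMC.sqrt_mul_sub_one hAL, MGMC.sqrt_mul_sub_one hAL, hκ.chain_cov hθ hθ₀,
      MGMC.scaled_conj hAL hTt hX]
    exact MGMC.norm_conj_le hT _
  refine ⟨hκ.chain_memLp hθ hθ₀, fun m => ?_, hstep, fun m => ?_, fun m s => ?_, fun h0 => ?_⟩
  · rw [hκ.chain_mean hθ hθ₀]
    exact MGMC.vecEnergyNorm_act_le hAL hT hX _
  · induction m with
    | zero => simp
    | succ m ih =>
      refine (hstep m).trans ((mul_le_mul_of_nonneg_left ih (by positivity)).trans_eq ?_)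
      rw [← mul_assoc, ← pow_add]
      congr 2
      ring
  · rw [hκ.chain_crossCov hθ hθ₀]
    exact MGMC.energyNorm_pow_mul_le hT hX s _
  · exact MGMC.exists_rate hAL hTt hT hX
      (K := fun m => MGMC.crossCov (θ m) (θ m) μ - (A L)⁻¹)
      (fun m => hκ.chain_cov hθ hθ₀ m) (sub_ne_zero.2 h0)
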